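/- Let $\Omega\subset\mathbb R^n$ be open, and let $C^1_0(\Omega,\mathbb R^n)$ be the space of $C^1$ vector fields $u$ on $\Omega$ such that $u$ and $Du$ vanish at $\partial\Omega$ and at infinity. Let $V\subset C^1_0(\Omega,\mathbb R^n)$ be an admissible Hilbert space, i.e. $\|u\|_\infty+\|Du\|_\infty\le C\|u\|_V$ for all $u\in V$, with a constant $C>0$. For $v\in L^2([0,1],V)$ let $\varphi^v_t$ be its flow: $\varphi^v_t$ is a $C^1$-diffeomorphism of $\Omega$ with $\partial_t\varphi^v_t(x)=v(t,\varphi^v_t(x))$, $\varphi^v_0(x)=x$. Let $X\subset C^1(\Omega)$ be a vector space of real functions (images), let $Y$ be a data space, and let $D:Y\times Y\to[0,\infty)$, $\mathcal T_t: X\to Y$, $g(t)\in Y$ ($t\in[0,1]$), $R_1:X\to[0,\infty)$ and $\mu_1,\mu_2\ge 0$ be arbitrary. For an action $\varphi . T$ of diffeomorphisms on images consider the joint model $$\text{(P)}\quad \min_{T\in X,\;v\in L^2([0,1],V)}\ \int_0^1\Bigl[D\bigl(\mathcal T_t(\varphi^v_t . T),g(t)\bigr)+\mu_2\int_0^t\|v(\tau,\cdot)\|_V^2\,d\tau\Bigr]dt+\mu_1R_1(T),$$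 where $\varphi^v$ is the flow of $v$, and the PDE-constrained problem $$\text{(Q)}\quad \min_{f,\;v\in L^2([0,1],V)}\ \int_0^1\Bigl[D\bigl(\mathcal T_t(f(t,\cdot)),g(t)\bigr)+\mu_2\int_0^t\|v(\tau,\cdot)\|_V^2\,d\tau\Bigr]dt+\mu_1R_1\bigl(f(0,\cdot)\bigr),$$ over $f:[0,1]\times\Omega\to\mathbb R$ with $f(t,\cdot)\in X$ for all $t$ and with $f$ and $\nabla f$ (the spatial gradient) continuous on $[0,1]\times\Omega$, subject to a partial differential equation for $(f,v)$. Objectives take values in $[0,\infty]$, with value $\infty$ if the data term is not measurable in $t$. Since $v$ is only square integrable in time, all time derivatives are understood in the Carathéodory (time-integrated) sense: $\partial_t w=h$ means $w(t)=w(0)+\int_0^t h(s)\,ds$ for all $t\in[0,1]$ with $h$ integrable, for each fixed $x\in\Omega$. Then each $v\in L^2([0,1],V)$ has exactly one flow $\varphi^v$, and the following hold. 1. (Geometric action, $\varphi . T=T\circ\varphi^{-1}$.) Suppose that $\varphi^v_t . T\in X$ for all $T\in X$, $v\in L^2([0,1],V)$, $t\in[0,1]$. Then (P) is equivalent to (Q)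 with the transport (optical-flow) equation $\partial_tf+\langle\nabla f,v\rangle=0$. 2. (Mass-preserving action, $\varphi . T=|D(\varphi^{-1})|\;T\circ\varphi^{-1}$, where $|D(\varphi^{-1})|$ is the determinant of the Jacobian of $\varphi^{-1}$.) Suppose that for all $T\in X$ and $v\in L^2([0,1],V)$ the trajectory $f(t,\cdot)=\varphi^v_t . T$ lies in $X$ for all $t\in[0,1]$ and that $f$ and $\nabla f$ are continuous on $[0,1]\times\Omega$. Then (P) is equivalent to (Q) with the continuity equation $\partial_tf+\nabla\cdot(f\,v)=0$. Here "equivalent" means: the map $(T,v)\mapsto(f,v)$ with $f(t,\cdot)=\varphi^v_t . T$ is a bijection from the feasible points of (P) onto those of (Q), with $f(0,\cdot)=T$; it preserves the objective; the optimal values of (P) and (Q) coincide; if $(T,v)$ is a minimizer of (P) then $(f,v)$ is a minimizer of (Q); and if $(f,v)$ is a minimizer of (Q) then $(f(0,\cdot),v)$ is a minimizer of (P) and $f(t,\cdot)=\varphi^v_t . f(0,\cdot)$ for all $t$. -/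

import Mathlib

open MeasureTheory Set Filter Topology
open scoped ENNReal NNReal unitInterval

noncomputable section

namespace LDDMM

/-- The space `ℝⁿ` with its Euclidean structure. -/
abbrev Euc (n : ℕ) : Type := EuclideanSpace ℝ (Fin n)

variable {n : ℕ} {Ω : TopologicalSpace.Opens (Euc n)}

/-! ### Calculus on an open set -/

open Classical in
/-- Extension by zero of a map on `Ω`. It is only ever differentiated at points of the open set
`Ω`, where the choice of the extension is irrelevant. -/
def extendZero {F : Type*} [Zero F] (u : Ω → F) : Euc n → F :=
  fun x => if h : x ∈ Ω then u ⟨x, h⟩ else 0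

/-- The derivative at `x ∈ Ω` of a map on `Ω`. -/
def jac {F : Type*} [NormedAddCommGroup F] [NormedSpace ℝ F] (u : Ω → F) (x : Ω) :
    Euc n →L[ℝ] F :=
  fderiv ℝ (extendZero u) x

/-- `u` is continuously differentiable on `Ω`. -/
def IsC1 {F : Type*} [NormedAddCommGroup F] [NormedSpace ℝ F] (u : Ω → F) : Prop :=
  ContDiffOn ℝ 1 (extendZero u) Ω

/-- The gradient at `x ∈ Ω` of a real function on `Ω`. -/
def grad (f : Ω → ℝ) (x : Ω) : Euc n := gradient (extendZero f) x

/-- The divergence at `x ∈ Ω` of a vector field on `Ω`: the trace of its Jacobian. -/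
def divergence (u : Ω → Euc n) (x : Ω) : ℝ :=
  LinearMap.trace ℝ (Euc n) (jac u x : Euc n →ₗ[ℝ] Euc n)

/-- `u ∈ C¹₀(Ω, ℝⁿ)`: `u` is continuously differentiable, and `u` and `Du` vanish at the boundary
of `Ω` and at infinity, i.e. they are small off compact subsets of `Ω`. -/
def IsC1Zero (u : Ω → Euc n) : Prop :=
  IsC1 u ∧ Tendsto u (cocompact Ω) (𝓝 0) ∧ Tendsto (jac u) (cocompact Ω) (𝓝 0)

/-! ### Velocity fields, diffeomorphisms and flows -/

section Velocity

variable {V : Type*} [NormedAddCommGroup V] [InnerProductSpace ℝ V]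

/-- The inner product space `V`, regarded as a space of vector fields on `Ω` through the injective
linear map `ev`, is contained in `C¹₀(Ω, ℝⁿ)`, and the inclusion is bounded:
`‖u‖_∞ + ‖Du‖_∞ ≤ C ‖u‖_V`. -/
structure IsAdmissible (ev : V →ₗ[ℝ] (Ω → Euc n)) : Prop where
  injective : Function.Injective ev
  isC1Zero : ∀ u : V, IsC1Zero (ev u)
  bound : ∃ C : ℝ, 0 < C ∧ ∀ (u : V) (x y : Ω), ‖ev u x‖ + ‖jac (ev u) y‖ ≤ C * ‖u‖

/-- The space `L²([0,1], V)` of time-dependent velocity fields. -/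
abbrev Velocity (V : Type*) [NormedAddCommGroup V] : Type _ :=
  Lp V 2 (volume : Measure I)

/-- A `C¹`-diffeomorphism of `Ω` onto itself. -/
structure Diffeo (Ω : TopologicalSpace.Opens (Euc n)) where
  toEquiv : Ω ≃ Ω
  isC1 : IsC1 (fun x => (toEquiv x : Euc n))
  isC1_symm : IsC1 (fun x => (toEquiv.symm x : Euc n))

/-- `φ` is the flow of the velocity field `v`: it solves `∂ₜ φₜ(x) = v(t, φₜ(x))`, `φ₀(x) = x` on
`[0,1]` in the Carathéodory sense (`v` is only square integrable in time), that is
`φₜ(x) = x + ∫₀ᵗ v(s, φₛ(x)) ds`. -/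
def IsFlow (ev : V →ₗ[ℝ] (Ω → Euc n)) (v : Velocity V) (φ : I → Diffeo Ω) : Prop :=
  ∀ x : Ω, Integrable (fun s : I => ev (v s) ((φ s).toEquiv x)) ∧
    ∀ t : I, ((φ t).toEquiv x : Euc n) = x + ∫ s in Iic t, ev (v s) ((φ s).toEquiv x)

/-! ### Group actions -/

/-- The geometric action `φ . f = f ∘ φ⁻¹`. -/
def geometricAction (φ : Diffeo Ω) (f : Ω → ℝ) : Ω → ℝ :=
  fun x => f (φ.toEquiv.symm x)

/-- The mass-preserving action `φ . f = |D(φ⁻¹)| (f ∘ φ⁻¹)`, where `|D(φ⁻¹)|` is the determinant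
of the Jacobian of `φ⁻¹`. -/
def massAction (φ : Diffeo Ω) (f : Ω → ℝ) : Ω → ℝ :=
  fun x => (jac (fun y => (φ.toEquiv.symm y : Euc n)) x).det * f (φ.toEquiv.symm x)

/-- The image trajectory `f(t, ·) = φₜ . T` generated by a template `T`. -/
def orbit (act : Diffeo Ω → (Ω → ℝ) → (Ω → ℝ)) (T : Ω → ℝ) (φ : I → Diffeo Ω) : I → Ω → ℝ :=
  fun t => act (φ t) T

/-! ### The partial differential equations -/

/-- `f` and its spatial gradient `∇f` are continuous on `[0,1] × Ω`. -/
def IsC1Trajectory (f : I → Ω → ℝ) : Prop :=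
  Continuous (fun p : I × Ω => f p.1 p.2) ∧ Continuous (fun p : I × Ω => grad (f p.1) p.2)

/-- The transport (optical flow) equation `∂ₜ f + ⟨∇f, v⟩ = 0` on `[0,1] × Ω`, where the time
derivative is taken in the Carathéodory sense:
`f(t,x) = f(0,x) - ∫₀ᵗ ⟨∇f(s,x), v(s,x)⟩ ds`. -/
def TransportEquation (ev : V →ₗ[ℝ] (Ω → Euc n)) (f : I → Ω → ℝ) (v : Velocity V) : Prop :=
  ∀ x : Ω, Integrable (fun s : I => inner ℝ (grad (f s) x) (ev (v s) x)) ∧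
    ∀ t : I, f t x = f 0 x - ∫ s in Iic t, inner ℝ (grad (f s) x) (ev (v s) x)

/-- The continuity equation `∂ₜ f + ∇·(f v) = 0` on `[0,1] × Ω`, where the time derivative is taken
in the Carathéodory sense: `f(t,x) = f(0,x) - ∫₀ᵗ ∇·(f(s,·) v(s,·))(x) ds`. -/
def ContinuityEquation (ev : V →ₗ[ℝ] (Ω → Euc n)) (f : I → Ω → ℝ) (v : Velocity V) : Prop :=
  ∀ x : Ω, Integrable (fun s : I => divergence (fun y => f s y • ev (v s) y) x) ∧
    ∀ t : I, f t x = f 0 x - ∫ s in Iic t, divergence (fun y => f s y • ev (v s) y) x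

/-! ### The two minimization problems -/

/-- A minimization problem: minimize `objective` over `feasible`. -/
structure MinProblem (α : Type*) where
  feasible : Set α
  objective : α → ℝ≥0∞

/-- `a` is a solution (a minimizer) of the problem `P`. -/
def MinProblem.IsSolution {α : Type*} (P : MinProblem α) (a : α) : Prop :=
  a ∈ P.feasible ∧ ∀ b ∈ P.feasible, P.objective a ≤ P.objective b

/-- The infimum of the objective of `P`. -/
def MinProblem.value {α : Type*} (P : MinProblem α) : ℝ≥0∞ :=
  ⨅ a ∈ P.feasible, P.objective a

variable {Y : Type*}

open Classical in
/-- The functional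
`∫₀¹ [D(Aₜ(f(t,·)), g(t)) + μ₂ ∫₀ᵗ ‖v(τ,·)‖²_V dτ] dt + μ₁ R₁(T)` with values in `[0,∞]`; it is
`∞` when the data term is not a measurable function of time. -/
def functional (D : Y → Y → ℝ≥0) (A : I → (Ω → ℝ) → Y) (g : I → Y) (R₁ : (Ω → ℝ) → ℝ≥0)
    (μ₁ μ₂ : ℝ≥0) (f : I → Ω → ℝ) (T : Ω → ℝ) (v : Velocity V) : ℝ≥0∞ :=
  if AEMeasurable (fun t : I => D (A t (f t)) (g t)) then
    (∫⁻ t : I, ((D (A t (f t)) (g t) : ℝ≥0∞) + μ₂ * ∫⁻ τ in Iic t, ‖v τ‖ₑ ^ 2)) + μ₁ * R₁ T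
  else ∞

/-- The joint model: minimize the functional of the trajectory `φₜ . T` and of `T` over templates
`T ∈ X` and velocity fields `v ∈ L²([0,1], V)`, subject to `φ` being the flow of `v`. -/
def jointModel (ev : V →ₗ[ℝ] (Ω → Euc n)) (X : Submodule ℝ (Ω → ℝ))
    (D : Y → Y → ℝ≥0) (A : I → (Ω → ℝ) → Y) (g : I → Y) (R₁ : (Ω → ℝ) → ℝ≥0) (μ₁ μ₂ : ℝ≥0)
    (act : Diffeo Ω → (Ω → ℝ) → (Ω → ℝ)) :
    MinProblem ((Ω → ℝ) × Velocity V × (I → Diffeo Ω)) where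
  feasible := {p | p.1 ∈ X ∧ IsFlow ev p.2.1 p.2.2}
  objective p := functional D A g R₁ μ₁ μ₂ (orbit act p.1 p.2.2) p.1 p.2.1

/-- The PDE-constrained problem: minimize the functional of the trajectory `f` and of `f(0,·)` over
trajectories `f` in `X`, with `f` and `∇f` continuous on `[0,1] × Ω`, and velocity fields
`v ∈ L²([0,1], V)`, subject to the equation `pde f v`. -/
def pdeProblem (X : Submodule ℝ (Ω → ℝ))
    (D : Y → Y → ℝ≥0) (A : I → (Ω → ℝ) → Y) (g : I → Y) (R₁ : (Ω → ℝ) → ℝ≥0) (μ₁ μ₂ : ℝ≥0)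
    (pde : (I → Ω → ℝ) → Velocity V → Prop) :
    MinProblem ((I → Ω → ℝ) × Velocity V) where
  feasible := {q | (∀ t, q.1 t ∈ X) ∧ IsC1Trajectory q.1 ∧ pde q.1 q.2}
  objective q := functional D A g R₁ μ₁ μ₂ q.1 (q.1 0) q.2

/-- The joint model `P` (in `(T, v, φ)`) and the PDE-constrained problem `Q` (in `(f, v)`) are
equivalent through `f(t,·) = φₜ . T`, `T = f(0,·)`. -/
structure AreEquivalent (act : Diffeo Ω → (Ω → ℝ) → (Ω → ℝ))
    (P : MinProblem ((Ω → ℝ) × Velocity V × (I → Diffeo Ω)))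
    (Q : MinProblem ((I → Ω → ℝ) × Velocity V)) : Prop where
  /-- `(T, v, φ) ↦ (f, v)` is a bijection between the feasible points. -/
  bijOn : BijOn (fun p => (orbit act p.1 p.2.2, p.2.1)) P.feasible Q.feasible
  /-- It preserves the objective, and `f(0,·) = T`. -/
  objective_eq : ∀ T v φ, (T, v, φ) ∈ P.feasible →
    orbit act T φ 0 = T ∧ Q.objective (orbit act T φ, v) = P.objective (T, v, φ)
  /-- The optimal values agree. -/
  value_eq : P.value = Q.value
  /-- A solution of `P` generates a solution of `Q`. -/
  solution_left : ∀ T v φ, P.IsSolution (T, v, φ) → Q.IsSolution (orbit act T φ, v)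
  /-- A solution of `Q` generates a solution of `P`, with template `f(0,·)`. -/
  solution_right : ∀ f v, Q.IsSolution (f, v) →
    ∃ φ, P.IsSolution (f 0, v, φ) ∧ f = orbit act (f 0) φ

end Velocity

end LDDMM

end

open LDDMM

/-!
Fields in `C¹₀(Ω, ℝⁿ)` extend by zero to `C¹` fields on `ℝⁿ`, so a velocity in `L²([0,1], V)`
becomes a Carathéodory field on the whole space with an integrable Lipschitz constant. Its flow
exists for all times, is `C¹` in space by the linearized equation, and fixes every point outside
`Ω`, hence preserves `Ω`.

The transport and the continuity equation are the cases `q = 0` and `q = tr` of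
`∂ₜ f + Df(v) + q(Dv) f = 0`. Along a trajectory of the flow this equation becomes the scalar linear
equation `w' = -q(Dv) w`, so `f(t, φₜ y) = f(0, y) exp (-∫₀ᵗ q(Dv))`. For `q = tr` the factor is
`det D(φₜ⁻¹)` by Liouville's formula. Hence the solutions are exactly the trajectories generated by
the action, and the feasible sets of the two problems correspond.

As `v` is only integrable in time, the chain rule along the flow holds only at the Lebesgue points
of `v`; it integrates because increments in time are locally bounded by multiples of `∫ ‖v‖`.
-/

noncomputable section

namespace LDDMM

/-! ### Primitives of locally integrable maps -/

section LocallyIntegrable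

variable {F : Type*} [NormedAddCommGroup F] {g : ℝ → F} {k : ℝ → ℝ}

theorem intervalIntegrable_of_locallyIntegrable (hg : LocallyIntegrable g) (a b : ℝ) :
    IntervalIntegrable g volume a b :=
  (hg.integrableOn_isCompact isCompact_uIcc).intervalIntegrable

theorem locallyIntegrable_norm (hg : LocallyIntegrable g) : LocallyIntegrable fun t => ‖g t‖ :=
  locallyIntegrableOn_univ.1 (hg.locallyIntegrableOn univ).norm

theorem locallyIntegrable_of_norm_le_mul {c : ℝ → ℝ} (hg : AEStronglyMeasurable g)
    (hk : LocallyIntegrable k) (hc : Continuous c) (h : ∀ t, ‖g t‖ ≤ c t * k t) :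
    LocallyIntegrable g :=
  (hk.continuous_mul hc).mono hg (.of_forall fun t => (h t).trans (le_abs_self _))

variable [NormedSpace ℝ F]

theorem norm_integral_le_mul_abs_integral {s t K : ℝ} (hK : 0 ≤ K) (hk : LocallyIntegrable k)
    (h : ∀ r ∈ uIcc s t, ‖g r‖ ≤ K * k r) :
    ‖∫ r in s..t, g r‖ ≤ K * |∫ r in s..t, k r| := by
  rw [← abs_of_nonneg hK, ← abs_mul, ← intervalIntegral.integral_const_mul]
  exact intervalIntegral.norm_integral_le_abs_of_norm_le
    (ae_restrict_of_forall_mem measurableSet_uIoc fun r hr => h r (uIoc_subset_uIcc hr))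
    ((intervalIntegrable_of_locallyIntegrable hk s t).const_mul K)

theorem locallyIntegrable_clm_comp {G : Type*} [NormedAddCommGroup G] [NormedSpace ℝ G]
    (hg : LocallyIntegrable g) (L : F →L[ℝ] G) : LocallyIntegrable fun t => L (g t) :=
  locallyIntegrable_of_norm_le_mul (L.continuous.comp_aestronglyMeasurable hg.aestronglyMeasurable)
    (locallyIntegrable_norm hg) continuous_const fun t => L.le_opNorm (g t)

end LocallyIntegrable

section AbsolutelyContinuous

variable {F : Type*} [NormedAddCommGroup F]

theorem absolutelyContinuousOnInterval_of_norm_sub_le {f : ℝ → F} {k : ℝ → ℝ} {a b K : ℝ}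
    (hk : LocallyIntegrable k)
    (h : ∀ s ∈ uIcc a b, ∀ t ∈ uIcc a b, ‖f t - f s‖ ≤ K * |∫ r in s..t, k r|) :
    AbsolutelyContinuousOnInterval f a b := by
  have hki := intervalIntegrable_of_locallyIntegrable hk
  have hK := ((hki a b).absolutelyContinuousOnInterval_intervalIntegral left_mem_uIcc).const_mul K
  refine squeeze_zero' (.of_forall fun E => Finset.sum_nonneg fun _ _ => dist_nonneg) ?_ <|
    by simpa only [AbsolutelyContinuousOnInterval, norm_zero] using hK.norm
  filter_upwards [mem_inf_of_right (mem_principal_self _)] with E hE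
  refine (Finset.sum_le_sum fun i hi => ?_).trans (le_abs_self _)
  obtain ⟨hs, ht⟩ := hE.1 i hi
  rw [dist_comm, dist_eq_norm, dist_comm, Real.dist_eq, ← mul_sub, abs_mul,
    intervalIntegral.integral_interval_sub_left (hki _ _) (hki _ _)]
  exact (h _ hs _ ht).trans (mul_le_mul_of_nonneg_right (le_abs_self K) (abs_nonneg _))

end AbsolutelyContinuous

section Primitive

variable {F G : Type*} [NormedAddCommGroup F] [NormedSpace ℝ F] [NormedAddCommGroup G]
  [NormedSpace ℝ G] {γ g : ℝ → F}

/-- `γ` is a primitive of the locally integrable map `g`: this is the meaning of `γ' = g` in the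
sense of Carathéodory. -/
def IsPrimitive (γ g : ℝ → F) : Prop :=
  LocallyIntegrable g ∧ ∀ s t, γ t - γ s = ∫ r in s..t, g r

theorem isPrimitive_of_eq_add_integral {x : F} {t₀ : ℝ} (hg : LocallyIntegrable g)
    (h : ∀ t, γ t = x + ∫ r in t₀..t, g r) : IsPrimitive γ g := by
  refine ⟨hg, fun s t => ?_⟩
  rw [h, h, add_sub_add_left_eq_sub, intervalIntegral.integral_interval_sub_left] <;>
    exact intervalIntegrable_of_locallyIntegrable hg _ _

theorem isPrimitive_integral (hg : LocallyIntegrable g) (t₀ : ℝ) :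
    IsPrimitive (fun t => ∫ r in t₀..t, g r) g :=
  isPrimitive_of_eq_add_integral hg fun _ => (zero_add _).symm

theorem isPrimitive_const (x : F) : IsPrimitive (fun _ => x) fun _ => 0 :=
  ⟨locallyIntegrable_zero, fun _ _ => by simp⟩

namespace IsPrimitive

theorem eq_add (h : IsPrimitive γ g) (s t : ℝ) : γ t = γ s + ∫ r in s..t, g r := by
  rw [← h.2 s t, add_sub_cancel]

protected theorem continuous (h : IsPrimitive γ g) : Continuous γ := by
  rw [funext (h.eq_add 0)]
  exact continuous_const.add
    (intervalIntegral.continuous_primitive (intervalIntegrable_of_locallyIntegrable h.1) 0)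

theorem sub {γ' g' : ℝ → F} (h : IsPrimitive γ g) (h' : IsPrimitive γ' g') :
    IsPrimitive (fun t => γ t - γ' t) (fun t => g t - g' t) := by
  refine ⟨h.1.sub h'.1, fun s t => ?_⟩
  rw [intervalIntegral.integral_sub (intervalIntegrable_of_locallyIntegrable h.1 s t)
    (intervalIntegrable_of_locallyIntegrable h'.1 s t), ← h.2, ← h'.2, sub_sub_sub_comm]

theorem clm_comp [CompleteSpace F] [CompleteSpace G] (h : IsPrimitive γ g) (L : F →L[ℝ] G) :
    IsPrimitive (fun t => L (γ t)) (fun t => L (g t)) := by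
  refine ⟨locallyIntegrable_clm_comp h.1 L, fun s t => ?_⟩
  rw [← map_sub, h.2,
    L.intervalIntegral_comp_comm (intervalIntegrable_of_locallyIntegrable h.1 s t)]

theorem norm_sub_le (h : IsPrimitive γ g) (s t : ℝ) :
    ‖γ t - γ s‖ ≤ |∫ r in s..t, ‖g r‖| := by
  rw [h.2]
  exact intervalIntegral.norm_integral_le_abs_integral_norm

variable [CompleteSpace F]

theorem ae_hasDerivAt (h : IsPrimitive γ g) : ∀ᵐ r, HasDerivAt γ (g r) r := by
  filter_upwards [LocallyIntegrable.ae_hasDerivAt_integral h.1] with r hr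
  rw [funext (h.eq_add 0)]
  exact (hr 0).const_add _

end IsPrimitive

variable [CompleteSpace F]

/-- The local absolute continuity of `γ` is what excludes Cantor functions here. -/
theorem isPrimitive_of_ae_hasDerivAt {k : ℝ → ℝ} (hg : LocallyIntegrable g)
    (hk : LocallyIntegrable k)
    (hγ : ∀ r, ∃ K, ∀ᶠ p : ℝ × ℝ in 𝓝 (r, r), ‖γ p.2 - γ p.1‖ ≤ K * |∫ τ in p.1..p.2, k τ|)
    (hderiv : ∀ᵐ r, HasDerivAt γ (g r) r) : IsPrimitive γ g := by
  set defect : ℝ → F := fun t => γ t - ∫ τ in 0..t, g τ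
  have hint := isPrimitive_integral hg 0
  have hdefect : ∀ᵐ r, HasDerivAt defect 0 r := by
    filter_upwards [hderiv, hint.ae_hasDerivAt] with r hr hr'
    exact (hr.sub hr').congr_deriv (sub_self _)
  have hloc : IsLocallyConstant defect := by
    refine (IsLocallyConstant.iff_eventually_eq _).2 fun r => ?_
    obtain ⟨K, hK⟩ := hγ r
    obtain ⟨δ, hδ, hball⟩ := Metric.eventually_nhds_iff_ball.1 hK
    have hsub : uIcc (r - δ / 2) (r + δ / 2) ⊆ Metric.ball r δ := by
      rw [uIcc_of_le (by linarith), ← Real.closedBall_eq_Icc]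
      exact Metric.closedBall_subset_ball (by linarith)
    have hacγ : AbsolutelyContinuousOnInterval γ (r - δ / 2) (r + δ / 2) :=
      absolutelyContinuousOnInterval_of_norm_sub_le hk fun s hs t ht =>
        hball (s, t) (by rw [← ball_prod_same]; exact ⟨hsub hs, hsub ht⟩)
    have hacint : AbsolutelyContinuousOnInterval (fun t => ∫ τ in 0..t, g τ)
        (r - δ / 2) (r + δ / 2) :=
      absolutelyContinuousOnInterval_of_norm_sub_le (K := 1) (locallyIntegrable_norm hg)
        fun s _ t _ => (one_mul |∫ τ in s..t, ‖g τ‖|).symm ▸ hint.norm_sub_le s t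
    obtain ⟨C, hC⟩ := (hacγ.sub hacint).const_of_ae_hasDerivAt_zero
      (hdefect.mono fun _ h _ => h)
    rw [uIcc_of_le (by linarith)] at hC
    filter_upwards [Icc_mem_nhds (by linarith : r - δ / 2 < r) (by linarith : r < r + δ / 2)]
      with t ht
    exact (hC t ht).trans (hC r ⟨by linarith, by linarith⟩).symm
  refine isPrimitive_of_eq_add_integral hg (x := defect 0) (t₀ := 0) fun t => ?_
  rw [hloc.apply_eq_of_preconnectedSpace 0 t, sub_add_cancel]

theorem IsPrimitive.comp_contDiff [CompleteSpace G] (h : IsPrimitive γ g) {f : F → G}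
    (hf : ContDiff ℝ 1 f) : IsPrimitive (fun t => f (γ t)) (fun t => fderiv ℝ f (γ t) (g t)) := by
  have hf' : Continuous fun t => fderiv ℝ f (γ t) :=
    (hf.continuous_fderiv one_ne_zero).comp h.continuous
  refine isPrimitive_of_ae_hasDerivAt ?_ (locallyIntegrable_norm h.1) (fun r => ?_) ?_
  · exact locallyIntegrable_of_norm_le_mul
      (isBoundedBilinearMap_apply.continuous.comp_aestronglyMeasurable
        (hf'.aestronglyMeasurable.prodMk h.1.aestronglyMeasurable))
      (locallyIntegrable_norm h.1) hf'.norm fun t => (fderiv ℝ f (γ t)).le_opNorm (g t)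
  · obtain ⟨K, U, hU, hK⟩ := hf.contDiffAt.exists_lipschitzOnWith (x := γ r)
    have hUr := h.continuous.continuousAt.preimage_mem_nhds hU
    refine ⟨K, ?_⟩
    filter_upwards [prod_mem_nhds hUr hUr] with p hp
    exact (hK.norm_sub_le hp.2 hp.1).trans
      (mul_le_mul_of_nonneg_left (h.norm_sub_le _ _) K.2)
  · filter_upwards [h.ae_hasDerivAt] with r hr
    exact ((hf.differentiable one_ne_zero) (γ r)).hasFDerivAt.comp_hasDerivAt r hr

end Primitive

section LebesguePoint

variable {V F : Type*} [NormedAddCommGroup V]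

/-- `r` is a Lebesgue point of `v`: the mean oscillation of `v` about `v r` over an interval
shrinking to `r` tends to zero. -/
def IsLebesguePoint (v : ℝ → V) (r : ℝ) : Prop :=
  HasDerivAt (fun t => ∫ s in r..t, ‖v s - v r‖) 0 r

theorem ae_isLebesguePoint {v : ℝ → V} (hv : LocallyIntegrable v) :
    ∀ᵐ r, IsLebesguePoint v r := by
  filter_upwards [(IsUnifLocDoublingMeasure.vitaliFamily volume 1).ae_tendsto_average_norm_sub hv]
    with r hr
  rw [IsLebesguePoint, hasDerivAt_iff_tendsto_slope_left_right]
  constructor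
  · refine (hr.comp r.tendsto_Icc_vitaliFamily_left).congr' ?_
    filter_upwards [self_mem_nhdsWithin] with t (ht : t < r)
    simp only [Function.comp_apply, setAverage_eq, Real.volume_real_Icc_of_le ht.le, slope,
      vsub_eq_sub, intervalIntegral.integral_same, sub_zero, intervalIntegral.integral_of_ge ht.le,
      integral_Icc_eq_integral_Ioc]
    rw [smul_neg, ← neg_smul, neg_inv, neg_sub]
  · refine (hr.comp r.tendsto_Icc_vitaliFamily_right).congr' ?_
    filter_upwards [self_mem_nhdsWithin] with t (ht : r < t)
    simp only [Function.comp_apply, setAverage_eq, Real.volume_real_Icc_of_le ht.le, slope,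
      vsub_eq_sub, intervalIntegral.integral_same, sub_zero, intervalIntegral.integral_of_le ht.le,
      integral_Icc_eq_integral_Ioc]

variable [NormedSpace ℝ V] [NormedAddCommGroup F] [NormedSpace ℝ F] {L : ℝ → V →ₗ[ℝ] F}

theorem exists_norm_apply_le_mul (hL : Continuous fun p : ℝ × V => L p.1 p.2) (r : ℝ) :
    ∃ K, ∀ᶠ s in 𝓝 r, ∀ u, ‖L s u‖ ≤ K * ‖u‖ := by
  have hzero : Tendsto (fun p : ℝ × V => L p.1 p.2) (𝓝 r ×ˢ 𝓝 0) (𝓝 0) := by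
    have := hL.tendsto (r, 0)
    rwa [nhds_prod_eq, map_zero] at this
  obtain ⟨p, hp, q, hq, hpq⟩ :=
    eventually_prod_iff.1 (hzero.eventually (Metric.ball_mem_nhds 0 one_pos))
  obtain ⟨δ, hδ, hball⟩ := Metric.eventually_nhds_iff_ball.1 hq
  refine ⟨2 / δ, hp.mono fun s hs u => ?_⟩
  rcases eq_or_ne u 0 with rfl | hu
  · simp
  have hscale : δ / (2 * ‖u‖) * ‖u‖ = δ / 2 := by field_simp
  have hsmall := hpq hs <| hball ((δ / (2 * ‖u‖)) • u) <| by
    rw [mem_ball_zero_iff, norm_smul, Real.norm_of_nonneg (by positivity), hscale]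
    exact half_lt_self hδ
  simp only [dist_zero_right, map_smul, norm_smul, norm_div, norm_mul, norm_norm,
    Real.norm_of_nonneg hδ.le, Real.norm_ofNat] at hsmall
  calc ‖L s u‖ = 2 / δ * ‖u‖ * (δ / (2 * ‖u‖) * ‖L s u‖) := by field_simp
    _ ≤ 2 / δ * ‖u‖ * 1 := by gcongr
    _ = 2 / δ * ‖u‖ := mul_one _

theorem locallyIntegrable_apply (hL : Continuous fun p : ℝ × V => L p.1 p.2)
    {v : ℝ → V} (hv : LocallyIntegrable v) : LocallyIntegrable fun s => L s (v s) := by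
  intro r
  obtain ⟨K, hK⟩ := exists_norm_apply_le_mul hL r
  obtain ⟨s, hs, hvs⟩ := hv r
  have hmeas : AEStronglyMeasurable fun t => L t (v t) :=
    hL.comp_aestronglyMeasurable (aestronglyMeasurable_id.prodMk hv.aestronglyMeasurable)
  set A := interior (s ∩ {t | ∀ u, ‖L t u‖ ≤ K * ‖u‖})
  have hA : A ⊆ s ∩ {t | ∀ u, ‖L t u‖ ≤ K * ‖u‖} := interior_subset
  refine ⟨A, interior_mem_nhds.2 (inter_mem hs hK), Integrable.mono'
    ((hvs.mono_set (hA.trans inter_subset_left)).norm.const_mul K) hmeas.restrict ?_⟩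
  exact ae_restrict_of_forall_mem isOpen_interior.measurableSet fun t ht => (hA ht).2 (v t)

theorem IsLebesguePoint.hasDerivAt_of_isPrimitive [CompleteSpace F] {v : ℝ → V} {r : ℝ}
    (hr : IsLebesguePoint v r) (hv : LocallyIntegrable v)
    (hL : Continuous fun p : ℝ × V => L p.1 p.2) {γ : ℝ → F}
    (hγ : IsPrimitive γ fun s => L s (v s)) : HasDerivAt γ (L r (v r)) r := by
  obtain ⟨K, hK⟩ := exists_norm_apply_le_mul hL r
  have hint : ∀ t, γ t - γ r - (t - r) • L r (v r) = ∫ s in r..t, (L s (v s) - L r (v r)) := by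
    intro t
    rw [intervalIntegral.integral_sub (intervalIntegrable_of_locallyIntegrable hγ.1 r t)
      intervalIntegrable_const, intervalIntegral.integral_const, hγ.2]
  have hosc : ∀ a b, IntervalIntegrable (fun s => ‖v s - v r‖) volume a b := fun a b =>
    ((intervalIntegrable_of_locallyIntegrable hv a b).sub intervalIntegrable_const).norm
  have hlittle : (fun t => K * ∫ s in r..t, ‖v s - v r‖) =o[𝓝 r] fun t => t - r := by
    simpa using hr.isLittleO.const_mul_left K
  rw [hasDerivAt_iff_isLittleO]
  refine Asymptotics.isLittleO_iff.2 fun ε hε => ?_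
  have hnear : ∀ᶠ s in 𝓝 r, ‖L s (v s) - L r (v r)‖ ≤ K * ‖v s - v r‖ + ε / 2 := by
    have hcont : Continuous fun s => L s (v r) := hL.comp (Continuous.prodMk_left (v r))
    filter_upwards [hK, Metric.continuousAt_iff'.1 hcont.continuousAt _ (half_pos hε)] with s hs hs'
    exact (norm_sub_le_norm_sub_add_norm_sub _ (L s (v r)) _).trans
      (add_le_add (map_sub (L s) _ _ ▸ hs _) (dist_eq_norm (L s (v r)) _ ▸ hs'.le))
  obtain ⟨δ, hδ, hball⟩ := Metric.eventually_nhds_iff_ball.1 hnear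
  filter_upwards [Metric.ball_mem_nhds r hδ, hlittle.bound (half_pos hε)] with t ht hosc_le
  rw [hint]
  calc ‖∫ s in r..t, (L s (v s) - L r (v r))‖
      ≤ |∫ s in r..t, (K * ‖v s - v r‖ + ε / 2)| :=
        intervalIntegral.norm_integral_le_abs_of_norm_le
          (ae_restrict_of_forall_mem measurableSet_uIoc fun s hs => hball s <|
            (convex_ball r δ).segment_subset (Metric.mem_ball_self hδ) ht <|
              segment_eq_uIcc r t ▸ uIoc_subset_uIcc hs)
          (((hosc r t).const_mul K).add intervalIntegrable_const)
    _ = |K * (∫ s in r..t, ‖v s - v r‖) + (t - r) * (ε / 2)| := by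
        rw [intervalIntegral.integral_add ((hosc r t).const_mul K) intervalIntegrable_const,
          intervalIntegral.integral_const_mul, intervalIntegral.integral_const, smul_eq_mul]
    _ ≤ ε / 2 * |t - r| + |t - r| * (ε / 2) :=
        (abs_add_le _ _).trans (add_le_add hosc_le (by rw [abs_mul, abs_of_pos (half_pos hε)]))
    _ = ε * ‖t - r‖ := by rw [Real.norm_eq_abs]; ring

end LebesguePoint

/-! ### Carathéodory differential equations -/

section Gronwall

variable {ℓ : ℝ → ℝ}

/-- The weight `cosh (2 ∫ ℓ)` centred at the time `t₀`. In the norm `‖γ‖ = sup |γ / weight|` the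
Picard operator of a field with Lipschitz constant `ℓ` is a contraction, see
`abs_integral_mul_weight_le`. -/
def weight (ℓ : ℝ → ℝ) (t₀ t : ℝ) : ℝ := Real.cosh (2 * ∫ r in t₀..t, ℓ r)

theorem one_le_weight (t₀ t : ℝ) : 1 ≤ weight ℓ t₀ t := Real.one_le_cosh _

theorem weight_pos (t₀ t : ℝ) : 0 < weight ℓ t₀ t := Real.cosh_pos _

theorem weight_comm (t₀ t : ℝ) : weight ℓ t₀ t = weight ℓ t t₀ := by
  rw [weight, weight, intervalIntegral.integral_symm, mul_neg, Real.cosh_neg]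

theorem continuous_weight (hℓ : LocallyIntegrable ℓ) (t₀ : ℝ) : Continuous (weight ℓ t₀) :=
  Real.continuous_cosh.comp (continuous_const.mul (isPrimitive_integral hℓ t₀).continuous)

theorem locallyIntegrable_mul_weight (hℓ : LocallyIntegrable ℓ) (t₀ : ℝ) :
    LocallyIntegrable fun t => ℓ t * weight ℓ t₀ t := by
  simpa only [smul_eq_mul, mul_comm] using hℓ.continuous_mul (continuous_weight hℓ t₀)

theorem integral_mul_weight (hℓ : LocallyIntegrable ℓ) (t₀ t : ℝ) :
    ∫ r in t₀..t, ℓ r * weight ℓ t₀ r = Real.sinh (2 * ∫ r in t₀..t, ℓ r) / 2 := by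
  have hderiv : ∀ y, fderiv ℝ (fun y => Real.sinh (2 * y) / 2) y =
      ContinuousLinearMap.toSpanSingleton ℝ (Real.cosh (2 * y)) := fun y =>
    ((((hasDerivAt_id y).const_mul 2).sinh.div_const 2).congr_deriv
      (by simp)).hasFDerivAt.fderiv
  have hprim := (isPrimitive_integral hℓ t₀).comp_contDiff
    (f := fun y => Real.sinh (2 * y) / 2) (by fun_prop)
  simpa [hderiv, weight] using (hprim.2 t₀ t).symm

theorem abs_integral_mul_weight_le (hℓ : LocallyIntegrable ℓ) (t₀ t : ℝ) :
    |∫ r in t₀..t, ℓ r * weight ℓ t₀ r| ≤ weight ℓ t₀ t / 2 := by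
  rw [integral_mul_weight hℓ, abs_div, Real.abs_sinh, abs_two, weight, ← Real.cosh_abs (2 * _)]
  exact div_le_div_of_nonneg_right (Real.sinh_lt_cosh _).le zero_le_two

theorem le_weight_mul_of_le_add_abs_integral (hℓ : LocallyIntegrable ℓ) (hℓ0 : ∀ t, 0 ≤ ℓ t)
    {u : ℝ → ℝ} (hu : Continuous u) (hu0 : ∀ t, 0 ≤ u t) {a t₀ t : ℝ}
    (h : ∀ s ∈ uIcc t₀ t, u s ≤ a + |∫ r in t₀..s, ℓ r * u r|) :
    u t ≤ 2 * weight ℓ t₀ t * a := by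
  obtain ⟨s, hs, hmax⟩ := isCompact_uIcc.exists_isMaxOn (nonempty_uIcc (a := t₀) (b := t))
    (hu.div (continuous_weight hℓ t₀) fun r => (weight_pos t₀ r).ne').continuousOn
  set M := u s / weight ℓ t₀ s
  have hM0 : 0 ≤ M := div_nonneg (hu0 s) (weight_pos t₀ s).le
  have hle : ∀ r ∈ uIcc t₀ t, u r ≤ M * weight ℓ t₀ r := fun r hr =>
    (div_le_iff₀ (weight_pos t₀ r)).1 (hmax hr)
  have hint : |∫ r in t₀..s, ℓ r * u r| ≤ M * (weight ℓ t₀ s / 2) := by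
    refine (norm_integral_le_mul_abs_integral (F := ℝ) hM0 (locallyIntegrable_mul_weight hℓ t₀)
      fun r hr => ?_).trans (mul_le_mul_of_nonneg_left (abs_integral_mul_weight_le hℓ t₀ s) hM0)
    rw [Real.norm_of_nonneg (mul_nonneg (hℓ0 r) (hu0 r)), mul_left_comm]
    exact mul_le_mul_of_nonneg_left (hle r (uIcc_subset_uIcc_left hs hr)) (hℓ0 r)
  have hM : M ≤ 2 * a := by
    have hus : u s = M * weight ℓ t₀ s := (div_mul_cancel₀ _ (weight_pos t₀ s).ne').symm
    linarith [h s hs, le_mul_of_one_le_right hM0 (one_le_weight (ℓ := ℓ) t₀ s)]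
  calc u t ≤ M * weight ℓ t₀ t := hle t right_mem_uIcc
    _ ≤ 2 * a * weight ℓ t₀ t := mul_le_mul_of_nonneg_right hM (weight_pos t₀ t).le
    _ = 2 * weight ℓ t₀ t * a := by ring

theorem IsPrimitive.norm_le_weight_mul {F : Type*} [NormedAddCommGroup F] [NormedSpace ℝ F]
    {δ d : ℝ → F} {ε : ℝ → ℝ} (hδ : IsPrimitive δ d) (hℓ : LocallyIntegrable ℓ)
    (hℓ0 : ∀ t, 0 ≤ ℓ t) (hε : LocallyIntegrable ε) (hε0 : ∀ t, 0 ≤ ε t)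
    (hd : ∀ t, ‖d t‖ ≤ ℓ t * ‖δ t‖ + ε t) (t₀ t : ℝ) :
    ‖δ t‖ ≤ 2 * weight ℓ t₀ t * (‖δ t₀‖ + |∫ r in t₀..t, ε r|) := by
  have hεi := intervalIntegrable_of_locallyIntegrable hε
  have hℓδ : LocallyIntegrable fun r => ℓ r * ‖δ r‖ := by
    simpa only [smul_eq_mul, mul_comm] using hℓ.continuous_mul hδ.continuous.norm
  refine le_weight_mul_of_le_add_abs_integral hℓ hℓ0 hδ.continuous.norm
    (fun _ => norm_nonneg _) fun s hs => ?_
  have hmono : |∫ r in t₀..s, ε r| ≤ |∫ r in t₀..t, ε r| :=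
    intervalIntegral.abs_integral_mono_interval
      (uIoc_subset_uIoc_of_uIcc_subset_uIcc (uIcc_subset_uIcc_left hs))
      (.of_forall hε0) (hεi _ _)
  calc ‖δ s‖ ≤ ‖δ t₀‖ + ‖∫ r in t₀..s, d r‖ := hδ.eq_add t₀ s ▸ norm_add_le _ _
    _ ≤ ‖δ t₀‖ + |∫ r in t₀..s, (ℓ r * ‖δ r‖ + ε r)| := by
        gcongr
        exact intervalIntegral.norm_integral_le_abs_of_norm_le (.of_forall hd)
          (intervalIntegrable_of_locallyIntegrable (hℓδ.add hε) _ _)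
    _ ≤ ‖δ t₀‖ + (|∫ r in t₀..s, ℓ r * ‖δ r‖| + |∫ r in t₀..s, ε r|) := by
        rw [intervalIntegral.integral_add (intervalIntegrable_of_locallyIntegrable hℓδ _ _)
          (hεi _ _)]
        gcongr
        exact abs_add_le _ _
    _ ≤ ‖δ t₀‖ + |∫ r in t₀..t, ε r| + |∫ r in t₀..s, ℓ r * ‖δ r‖| := by linarith

end Gronwall

section ODE

variable {F : Type*} [NormedAddCommGroup F] {g : ℝ → F → F} {ℓ : ℝ → ℝ}

/-- `g` is a time-dependent vector field that is `ℓ t`-Lipschitz at time `t`, with `ℓ` locally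
integrable. Measurability in time is only asked for along continuous curves. -/
structure IsCaratheodory (g : ℝ → F → F) (ℓ : ℝ → ℝ) : Prop where
  locallyIntegrable : LocallyIntegrable ℓ
  nonneg : ∀ t, 0 ≤ ℓ t
  norm_sub_le : ∀ t x y, ‖g t x - g t y‖ ≤ ℓ t * ‖x - y‖
  norm_zero_le : ∀ t, ‖g t 0‖ ≤ ℓ t
  aestronglyMeasurable : ∀ γ : ℝ → F, Continuous γ → AEStronglyMeasurable fun t => g t (γ t)

namespace IsCaratheodory

theorem norm_le (h : IsCaratheodory g ℓ) (t : ℝ) (x : F) : ‖g t x‖ ≤ (1 + ‖x‖) * ℓ t := by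
  have hsub := h.norm_sub_le t x 0
  rw [sub_zero] at hsub
  linarith [h.norm_zero_le t, norm_sub_norm_le (g t x) (g t 0)]

theorem locallyIntegrable_comp (h : IsCaratheodory g ℓ) {γ : ℝ → F} (hγ : Continuous γ) :
    LocallyIntegrable fun t => g t (γ t) :=
  locallyIntegrable_of_norm_le_mul (h.aestronglyMeasurable γ hγ) h.locallyIntegrable
    (continuous_const.add hγ.norm) fun t => h.norm_le t (γ t)

variable [NormedSpace ℝ F]

section Picard

open scoped BoundedContinuousFunction

theorem locallyIntegrable_comp_weight_smul (h : IsCaratheodory g ℓ) (t₀ : ℝ) (η : ℝ →ᵇ F) :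
    LocallyIntegrable fun r => g r (weight ℓ t₀ r • η r) :=
  h.locallyIntegrable_comp ((continuous_weight h.locallyIntegrable t₀).smul η.continuous)

theorem norm_integral_comp_weight_smul_le (h : IsCaratheodory g ℓ) (t₀ t : ℝ) (η : ℝ →ᵇ F) :
    ‖∫ r in t₀..t, g r (weight ℓ t₀ r • η r)‖ ≤ (1 + ‖η‖) * (weight ℓ t₀ t / 2) := by
  have hη : 0 ≤ 1 + ‖η‖ := by positivity
  refine (norm_integral_le_mul_abs_integral hη
    (locallyIntegrable_mul_weight h.locallyIntegrable t₀) fun r _ => ?_).trans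
    (mul_le_mul_of_nonneg_left (abs_integral_mul_weight_le h.locallyIntegrable t₀ t) hη)
  have hw := one_le_weight (ℓ := ℓ) t₀ r
  calc ‖g r (weight ℓ t₀ r • η r)‖ ≤ (1 + weight ℓ t₀ r * ‖η r‖) * ℓ r := by
        simpa only [norm_smul, Real.norm_of_nonneg (weight_pos t₀ r).le]
          using h.norm_le r (weight ℓ t₀ r • η r)
    _ ≤ (weight ℓ t₀ r + weight ℓ t₀ r * ‖η‖) * ℓ r := by
        gcongr
        · exact h.nonneg r
        · exact η.norm_coe_le_norm r
    _ = (1 + ‖η‖) * (ℓ r * weight ℓ t₀ r) := by ring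

theorem norm_integral_comp_weight_smul_sub_le (h : IsCaratheodory g ℓ) (t₀ t : ℝ)
    (η₁ η₂ : ℝ →ᵇ F) :
    ‖(∫ r in t₀..t, g r (weight ℓ t₀ r • η₁ r)) - ∫ r in t₀..t, g r (weight ℓ t₀ r • η₂ r)‖ ≤
      dist η₁ η₂ * (weight ℓ t₀ t / 2) := by
  have hint := fun η => intervalIntegrable_of_locallyIntegrable
    (h.locallyIntegrable_comp_weight_smul t₀ η) t₀ t
  rw [← intervalIntegral.integral_sub (hint η₁) (hint η₂)]
  refine (norm_integral_le_mul_abs_integral dist_nonneg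
    (locallyIntegrable_mul_weight h.locallyIntegrable t₀) fun r _ => ?_).trans
    (mul_le_mul_of_nonneg_left (abs_integral_mul_weight_le h.locallyIntegrable t₀ t) dist_nonneg)
  calc _ ≤ ℓ r * ‖weight ℓ t₀ r • η₁ r - weight ℓ t₀ r • η₂ r‖ := h.norm_sub_le _ _ _
    _ = ℓ r * weight ℓ t₀ r * dist (η₁ r) (η₂ r) := by
        rw [← smul_sub, norm_smul, Real.norm_of_nonneg (weight_pos t₀ r).le, dist_eq_norm,
          mul_assoc]
    _ ≤ ℓ r * weight ℓ t₀ r * dist η₁ η₂ := mul_le_mul_of_nonneg_left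
        (BoundedContinuousFunction.dist_coe_le_dist r)
        (mul_nonneg (h.nonneg r) (weight_pos t₀ r).le)
    _ = dist η₁ η₂ * (ℓ r * weight ℓ t₀ r) := mul_comm _ _

/-- The Picard operator of the initial value problem `γ' = g(t, γ)`, `γ t₀ = x`, in the unknown
`η = γ / weight`, which is bounded although `γ` need not be. -/
def picard (h : IsCaratheodory g ℓ) (t₀ : ℝ) (x : F) (η : ℝ →ᵇ F) : ℝ →ᵇ F :=
  BoundedContinuousFunction.ofNormedAddCommGroup
    (fun t => (weight ℓ t₀ t)⁻¹ • (x + ∫ r in t₀..t, g r (weight ℓ t₀ r • η r)))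
    (((continuous_weight h.locallyIntegrable t₀).inv₀ fun t => (weight_pos t₀ t).ne').smul
      (continuous_const.add
        (isPrimitive_integral (h.locallyIntegrable_comp_weight_smul t₀ η) t₀).continuous))
    (‖x‖ + (1 + ‖η‖) / 2) fun t => by
      rw [norm_smul, norm_inv, Real.norm_of_nonneg (weight_pos t₀ t).le,
        inv_mul_le_iff₀ (weight_pos t₀ t)]
      linarith [norm_add_le x (∫ r in t₀..t, g r (weight ℓ t₀ r • η r)),
        h.norm_integral_comp_weight_smul_le t₀ t η,
        le_mul_of_one_le_left (norm_nonneg x) (one_le_weight (ℓ := ℓ) t₀ t)]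

theorem contractingWith_picard (h : IsCaratheodory g ℓ) (t₀ : ℝ) (x : F) :
    ContractingWith (1 / 2) (h.picard t₀ x) := by
  refine ⟨NNReal.half_lt_self one_ne_zero, .of_dist_le_mul fun η₁ η₂ => ?_⟩
  refine (BoundedContinuousFunction.dist_le (by positivity)).2 fun t => ?_
  simp only [picard, BoundedContinuousFunction.coe_ofNormedAddCommGroup]
  rw [dist_eq_norm, ← smul_sub, add_sub_add_left_eq_sub, norm_smul, norm_inv,
    Real.norm_of_nonneg (weight_pos t₀ t).le, inv_mul_le_iff₀ (weight_pos t₀ t)]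
  refine (h.norm_integral_comp_weight_smul_sub_le t₀ t η₁ η₂).trans_eq ?_
  push_cast
  ring

theorem exists_isPrimitive [CompleteSpace F] (h : IsCaratheodory g ℓ) (t₀ : ℝ) (x : F) :
    ∃ γ : ℝ → F, γ t₀ = x ∧ IsPrimitive γ fun r => g r (γ r) := by
  set η := (h.contractingWith_picard t₀ x).fixedPoint
  have hη : ∀ t, weight ℓ t₀ t • η t = x + ∫ r in t₀..t, g r (weight ℓ t₀ r • η r) := by
    intro t
    have hfix : h.picard t₀ x η t = η t :=
      congrArg (· t) (h.contractingWith_picard t₀ x).fixedPoint_isFixedPt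
    rw [← hfix]
    exact smul_inv_smul₀ (weight_pos t₀ t).ne' _
  refine ⟨fun t => weight ℓ t₀ t • η t, by simp [hη t₀], ?_⟩
  exact isPrimitive_of_eq_add_integral (h.locallyIntegrable_comp_weight_smul t₀ η) hη

end Picard

theorem norm_solution_sub_le (h : IsCaratheodory g ℓ) {γ₁ γ₂ : ℝ → F}
    (h₁ : IsPrimitive γ₁ fun r => g r (γ₁ r)) (h₂ : IsPrimitive γ₂ fun r => g r (γ₂ r))
    (t₀ t : ℝ) : ‖γ₁ t - γ₂ t‖ ≤ 2 * weight ℓ t₀ t * ‖γ₁ t₀ - γ₂ t₀‖ := by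
  simpa using (h₁.sub h₂).norm_le_weight_mul h.locallyIntegrable h.nonneg
    (ε := fun _ => 0) locallyIntegrable_zero (fun _ => le_rfl)
    (fun r => by simpa using h.norm_sub_le r (γ₁ r) (γ₂ r)) t₀ t

theorem solution_unique (h : IsCaratheodory g ℓ) {γ₁ γ₂ : ℝ → F}
    (h₁ : IsPrimitive γ₁ fun r => g r (γ₁ r)) (h₂ : IsPrimitive γ₂ fun r => g r (γ₂ r))
    {t₀ : ℝ} (h₀ : γ₁ t₀ = γ₂ t₀) : γ₁ = γ₂ := by
  ext t
  simpa [h₀, sub_eq_zero] using h.norm_solution_sub_le h₁ h₂ t₀ t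

end IsCaratheodory

end ODE

/-! ### Scalar linear equations and Liouville's formula -/

section ScalarLinear

theorem isPrimitive_mul_exp_integral {c : ℝ → ℝ} (hc : LocallyIntegrable c) (a t₀ : ℝ) :
    IsPrimitive (fun t => a * Real.exp (∫ r in t₀..t, c r))
      fun t => c t * (a * Real.exp (∫ r in t₀..t, c r)) := by
  have hderiv : ∀ y, fderiv ℝ (fun y => a * Real.exp y) y =
      ContinuousLinearMap.toSpanSingleton ℝ (a * Real.exp y) := fun y =>
    ((Real.hasDerivAt_exp y).const_mul a).hasFDerivAt.fderiv
  simpa only [hderiv, ContinuousLinearMap.toSpanSingleton_apply, smul_eq_mul] using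
    (isPrimitive_integral hc t₀).comp_contDiff (f := fun y => a * Real.exp y) (by fun_prop)

theorem IsPrimitive.eq_mul_exp_integral {γ c : ℝ → ℝ} (hc : LocallyIntegrable c)
    (h : IsPrimitive γ fun t => c t * γ t) (s t : ℝ) :
    γ t = γ s * Real.exp (∫ r in s..t, c r) := by
  have hdiff := (h.sub (isPrimitive_mul_exp_integral hc (γ s) s)).norm_le_weight_mul
    (locallyIntegrable_norm hc) (fun _ => norm_nonneg _) (ε := fun _ => 0) locallyIntegrable_zero
    (fun _ => le_rfl) (fun r => by rw [← mul_sub, norm_mul, add_zero]) s t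
  simpa [sub_eq_zero] using hdiff

theorem isPrimitive_iff_eq_mul_exp_integral {γ c : ℝ → ℝ} (hc : LocallyIntegrable c) (t₀ : ℝ) :
    IsPrimitive γ (fun t => c t * γ t) ↔ ∀ t, γ t = γ t₀ * Real.exp (∫ r in t₀..t, c r) := by
  refine ⟨fun h t => h.eq_mul_exp_integral hc t₀ t, fun h => ?_⟩
  rw [funext h]
  simpa only [intervalIntegral.integral_same, Real.exp_zero, mul_one] using
    isPrimitive_mul_exp_integral hc (γ t₀) t₀

end ScalarLinear

section Liouville

variable {E : Type*} [NormedAddCommGroup E] [NormedSpace ℝ E] [FiniteDimensional ℝ E]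

theorem contDiff_det : ContDiff ℝ 1 fun Z : E →L[ℝ] E => Z.det := by
  set b := Module.finBasis ℝ E
  have hdet : (fun Z : E →L[ℝ] E => Z.det) = fun Z : E →L[ℝ] E =>
      (LinearMap.toMatrix b b (Z : E →ₗ[ℝ] E)).det := by
    ext Z
    rw [LinearMap.det_toMatrix]
  rw [hdet]
  simp only [Matrix.det_apply]
  refine ContDiff.sum fun τ _ => .const_smul _ (contDiff_prod fun i _ => ?_)
  exact (LinearMap.toContinuousLinearMap (Matrix.entryLinearMap ℝ ℝ (τ i) i ∘ₗ
    (LinearMap.toMatrix b b).toLinearMap ∘ₗ ContinuousLinearMap.coeLM ℝ)).contDiff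

theorem hasDerivAt_det_one_add_smul (A : E →L[ℝ] E) :
    HasDerivAt (fun r : ℝ => (1 + r • A).det) (LinearMap.trace ℝ E (A : E →ₗ[ℝ] E)) 0 := by
  set b := Module.finBasis ℝ E
  set M := LinearMap.toMatrix b b (A : E →ₗ[ℝ] E)
  set p := (Matrix.det (1 + (Polynomial.X : Polynomial ℝ) • M.map Polynomial.C)).divX.divX
  have hexpand : ∀ r : ℝ, (1 + r • A).det = 1 + M.trace * r + p.eval r * r ^ 2 := by
    intro r
    rw [← Matrix.det_one_add_smul, ContinuousLinearMap.det, ← LinearMap.det_toMatrix b]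
    congr 1
    change LinearMap.toMatrix b b (1 + r • (A : E →ₗ[ℝ] E)) = 1 + r • M
    rw [map_add, map_smul, LinearMap.toMatrix_one]
  rw [funext hexpand, LinearMap.trace_eq_matrix_trace ℝ b]
  exact ((((hasDerivAt_id (0 : ℝ)).const_mul M.trace).const_add 1).add
    ((p.hasDerivAt 0).mul (hasDerivAt_pow 2 (0 : ℝ)))).congr_deriv (by simp [M])

theorem fderiv_det_comp (Z A : E →L[ℝ] E) :
    fderiv ℝ (fun Z : E →L[ℝ] E => Z.det) Z (A ∘L Z) =
      LinearMap.trace ℝ E (A : E →ₗ[ℝ] E) * Z.det := by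
  have hline : HasDerivAt (fun r : ℝ => Z + r • (A ∘L Z)) (A ∘L Z) 0 := by
    simpa using ((hasDerivAt_id (0 : ℝ)).smul_const (A ∘L Z)).const_add Z
  have hfactor : ∀ r : ℝ, (Z + r • (A ∘L Z)).det = (1 + r • A).det * Z.det := fun r => by
    have hcomp : Z + r • (A ∘L Z) = (1 + r • A) ∘L Z := by ext x; simp
    rw [hcomp]
    exact LinearMap.det_comp ((1 + r • A : E →L[ℝ] E) : E →ₗ[ℝ] E) (Z : E →ₗ[ℝ] E)
  have hchain := (contDiff_det.differentiable one_ne_zero _).hasFDerivAt.comp_hasDerivAt 0 hline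
  simp only [Function.comp_def, hfactor, zero_smul, add_zero] at hchain
  exact hchain.unique ((hasDerivAt_det_one_add_smul A).mul_const Z.det)

/-- The trace as a continuous linear functional. -/
def traceCLM (E : Type*) [NormedAddCommGroup E] [NormedSpace ℝ E] [FiniteDimensional ℝ E] :
    (E →L[ℝ] E) →L[ℝ] ℝ :=
  LinearMap.toContinuousLinearMap (LinearMap.trace ℝ E ∘ₗ ContinuousLinearMap.coeLM ℝ)

theorem IsPrimitive.det_eq {Z A : ℝ → E →L[ℝ] E} (hA : LocallyIntegrable A)
    (h : IsPrimitive Z fun t => A t ∘L Z t) (s t : ℝ) :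
    (Z t).det = (Z s).det * Real.exp (∫ r in s..t, traceCLM E (A r)) := by
  have hdet := h.comp_contDiff contDiff_det
  simp only [fderiv_det_comp] at hdet
  exact hdet.eq_mul_exp_integral (locallyIntegrable_clm_comp hA (traceCLM E)) s t

end Liouville

/-! ### Flows of Carathéodory fields -/

section ContinuousDependence

variable {Y F : Type*} [TopologicalSpace Y] [FirstCountableTopology Y]
  [NormedAddCommGroup F] [NormedSpace ℝ F]

theorem continuousAt_integral_of_dominated {f : Y → ℝ → F} {k : ℝ → ℝ} {y₀ : Y}
    (hf : ∀ y, AEStronglyMeasurable (f y)) (hk : LocallyIntegrable k)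
    (hle : ∀ y t, ‖f y t‖ ≤ k t) (hcont : ∀ t, ContinuousAt (fun y => f y t) y₀) (t₀ t₁ : ℝ) :
    ContinuousAt (fun p : Y × ℝ => ∫ r in t₀..p.2, f p.1 r) (y₀, t₁) := by
  have hmin : min t₀ t₁ - 1 < min t₀ t₁ := by linarith
  have hmax : max t₀ t₁ < max t₀ t₁ + 1 := by linarith
  exact intervalIntegral.continuousAt_parametric_primitive_of_dominated k
    (min t₀ t₁ - 1) (max t₀ t₁ + 1) (fun y => (hf y).restrict)
    (.of_forall fun y => .of_forall fun t => hle y t)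
    (intervalIntegrable_of_locallyIntegrable hk _ _) (.of_forall hcont)
    ⟨hmin.trans_le (min_le_left _ _), (le_max_left _ _).trans_lt hmax⟩
    ⟨hmin.trans_le (min_le_right _ _), (le_max_right _ _).trans_lt hmax⟩ Real.volume_singleton

theorem tendsto_zero_of_isPrimitive {δ d : Y → ℝ → F} {ε : Y → ℝ → ℝ} {ℓ k : ℝ → ℝ} {y₀ : Y}
    {t₀ : ℝ} (hδ : ∀ y, IsPrimitive (δ y) (d y)) (hδ₀ : ∀ y, δ y t₀ = 0)
    (hℓ : LocallyIntegrable ℓ) (hℓ0 : ∀ t, 0 ≤ ℓ t)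
    (hd : ∀ y t, ‖d y t‖ ≤ ℓ t * ‖δ y t‖ + ε y t) (hε0 : ∀ y t, 0 ≤ ε y t)
    (hεm : ∀ y, AEStronglyMeasurable (ε y)) (hk : LocallyIntegrable k)
    (hεk : ∀ y t, ε y t ≤ k t) (hlim : ∀ t, Tendsto (fun y => ε y t) (𝓝 y₀) (𝓝 0)) (t₁ : ℝ) :
    Tendsto (fun p : ℝ × Y => δ p.2 p.1) (𝓝 (t₁, y₀)) (𝓝 0) := by
  have hε₀ : ∀ t, ε y₀ t = 0 := fun t =>
    (tendsto_nhds_unique ((hlim t).mono_left (pure_le_nhds y₀)) (tendsto_pure_nhds _ _)).symm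
  have hε : ∀ y t, ‖ε y t‖ ≤ k t := fun y t => (Real.norm_of_nonneg (hε0 y t)).trans_le (hεk y t)
  have hint : Tendsto (fun p : ℝ × Y => |∫ r in t₀..p.1, ε p.2 r|) (𝓝 (t₁, y₀)) (𝓝 0) := by
    have hcont : ContinuousAt (fun p : Y × ℝ => ∫ r in t₀..p.2, ε p.1 r) (y₀, t₁) :=
      continuousAt_integral_of_dominated hεm hk hε
        (fun t => by simpa only [ContinuousAt, hε₀] using hlim t) t₀ t₁
    simpa [hε₀] using (hcont.tendsto.comp (continuous_swap.tendsto (t₁, y₀))).abs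
  have hweight : Tendsto (fun p : ℝ × Y => 2 * weight ℓ t₀ p.1) (𝓝 (t₁, y₀))
      (𝓝 (2 * weight ℓ t₀ t₁)) :=
    ((continuous_const.mul (continuous_weight hℓ t₀)).comp continuous_fst).tendsto _
  refine squeeze_zero_norm (fun p => ?_) (by simpa only [mul_zero] using hweight.mul hint)
  have hεloc : LocallyIntegrable (ε p.2) :=
    locallyIntegrable_of_norm_le_mul (hεm p.2) hk (c := fun _ => 1) continuous_const
      fun t => by simpa only [one_mul] using hε p.2 t
  simpa only [hδ₀, norm_zero, zero_add] using
    (hδ p.2).norm_le_weight_mul hℓ hℓ0 hεloc (hε0 p.2) (hd p.2) t₀ p.1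

end ContinuousDependence

section Flow

variable {E : Type*} [NormedAddCommGroup E] [NormedSpace ℝ E] {g : ℝ → E → E} {ℓ : ℝ → ℝ}

namespace IsCaratheodory

variable [CompleteSpace E] (h : IsCaratheodory g ℓ)

/-- The flow of the field `g`: `h.flow t₀ t x` is the value at time `t` of the solution that passes
through `x` at time `t₀`. -/
def flow (t₀ t : ℝ) (x : E) : E := (h.exists_isPrimitive t₀ x).choose t

@[simp]
theorem flow_self (t₀ : ℝ) (x : E) : h.flow t₀ t₀ x = x :=
  (h.exists_isPrimitive t₀ x).choose_spec.1

theorem isPrimitive_flow (t₀ : ℝ) (x : E) :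
    IsPrimitive (fun t => h.flow t₀ t x) fun r => g r (h.flow t₀ r x) :=
  (h.exists_isPrimitive t₀ x).choose_spec.2

theorem eq_flow {γ : ℝ → E} (hγ : IsPrimitive γ fun r => g r (γ r)) (t₀ t : ℝ) :
    γ t = h.flow t₀ t (γ t₀) :=
  congrFun (h.solution_unique hγ (h.isPrimitive_flow t₀ (γ t₀)) (h.flow_self t₀ _).symm) t

theorem flow_flow (r s t : ℝ) (x : E) : h.flow s t (h.flow r s x) = h.flow r t x :=
  (h.eq_flow (h.isPrimitive_flow r x) s t).symm

theorem norm_flow_sub_flow_le (t₀ t : ℝ) (x y : E) :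
    ‖h.flow t₀ t x - h.flow t₀ t y‖ ≤ 2 * weight ℓ t₀ t * ‖x - y‖ := by
  simpa only [flow_self] using
    h.norm_solution_sub_le (h.isPrimitive_flow t₀ x) (h.isPrimitive_flow t₀ y) t₀ t

theorem continuous_flow_apply (t₀ t : ℝ) : Continuous (h.flow t₀ t) :=
  (LipschitzWith.of_dist_le' (K := 2 * weight ℓ t₀ t) fun x y => by
    simpa only [dist_eq_norm] using h.norm_flow_sub_flow_le t₀ t x y).continuous

theorem continuous_flow_symm (t₀ : ℝ) : Continuous fun p : ℝ × E => h.flow p.1 t₀ p.2 := by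
  refine continuous_iff_continuousAt.2 fun ⟨t₁, x⟩ => tendsto_iff_norm_sub_tendsto_zero.2 ?_
  set y := h.flow t₁ t₀ x with hy
  have hcont : Continuous fun p : ℝ × E => 2 * weight ℓ t₀ p.1 * ‖p.2 - h.flow t₀ p.1 y‖ :=
    (continuous_const.mul ((continuous_weight h.locallyIntegrable t₀).comp continuous_fst)).mul
      (continuous_snd.sub ((h.isPrimitive_flow t₀ y).continuous.comp continuous_fst)).norm
  have hlim := hcont.tendsto (t₁, x)
  simp only [hy, flow_flow, flow_self, sub_self, norm_zero, mul_zero] at hlim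
  refine squeeze_zero (fun _ => norm_nonneg _) (fun p => ?_) hlim
  simpa only [flow_flow, flow_self, weight_comm p.1] using
    h.norm_flow_sub_flow_le p.1 t₀ p.2 (h.flow t₁ p.1 x)

end IsCaratheodory

/-- A Carathéodory field that is continuously differentiable in space. Its derivative is bounded by
the Lipschitz constant `ℓ`; as for the field, measurability in time is only asked for along
continuous curves. -/
structure IsC1Caratheodory (g : ℝ → E → E) (ℓ : ℝ → ℝ) : Prop extends IsCaratheodory g ℓ where
  contDiff : ∀ t, ContDiff ℝ 1 (g t)
  aestronglyMeasurable_fderiv : ∀ γ : ℝ → E, Continuous γ →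
    AEStronglyMeasurable fun t => fderiv ℝ (g t) (γ t)

namespace IsC1Caratheodory

theorem hasFDerivAt (h : IsC1Caratheodory g ℓ) (t : ℝ) (x : E) :
    HasFDerivAt (g t) (fderiv ℝ (g t) x) x :=
  ((h.contDiff t).differentiable one_ne_zero x).hasFDerivAt

theorem norm_fderiv_le (h : IsC1Caratheodory g ℓ) (t : ℝ) (x : E) : ‖fderiv ℝ (g t) x‖ ≤ ℓ t :=
  norm_fderiv_le_of_lip' ℝ (h.nonneg t) (.of_forall fun y => h.norm_sub_le t y x)

theorem locallyIntegrable_fderiv (h : IsC1Caratheodory g ℓ) {γ : ℝ → E} (hγ : Continuous γ) :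
    LocallyIntegrable fun t => fderiv ℝ (g t) (γ t) :=
  locallyIntegrable_of_norm_le_mul (h.aestronglyMeasurable_fderiv γ hγ) h.locallyIntegrable
    (c := fun _ => 1) continuous_const fun t => by simpa only [one_mul] using h.norm_fderiv_le t _

theorem isCaratheodory_linearization (h : IsC1Caratheodory g ℓ) {γ : ℝ → E} (hγ : Continuous γ) :
    IsCaratheodory (fun t (Z : E →L[ℝ] E) => fderiv ℝ (g t) (γ t) ∘L Z) ℓ where
  locallyIntegrable := h.locallyIntegrable
  nonneg := h.nonneg
  norm_sub_le t Z W := by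
    rw [← ContinuousLinearMap.comp_sub]
    exact (ContinuousLinearMap.opNorm_comp_le _ _).trans
      (mul_le_mul_of_nonneg_right (h.norm_fderiv_le t _) (norm_nonneg _))
  norm_zero_le t := by
    rw [ContinuousLinearMap.comp_zero, norm_zero]
    exact h.nonneg t
  aestronglyMeasurable Z hZ := (ContinuousLinearMap.compL ℝ E E E).aestronglyMeasurable_comp₂
    (h.aestronglyMeasurable_fderiv γ hγ) hZ.aestronglyMeasurable

variable [CompleteSpace E] (h : IsC1Caratheodory g ℓ)

/-- The spatial derivative of the flow, defined as the solution of the linearized equation along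
the trajectory of `x`, see `hasFDerivAt_flow`. -/
def flowDeriv (t₀ t : ℝ) (x : E) : E →L[ℝ] E :=
  (h.isCaratheodory_linearization (h.isPrimitive_flow t₀ x).continuous).flow t₀ t
    (ContinuousLinearMap.id ℝ E)

@[simp]
theorem flowDeriv_self (t : ℝ) (x : E) : h.flowDeriv t t x = ContinuousLinearMap.id ℝ E :=
  IsCaratheodory.flow_self _ t _

theorem isPrimitive_flowDeriv (t₀ : ℝ) (x : E) : IsPrimitive (fun t => h.flowDeriv t₀ t x)
    fun r => fderiv ℝ (g r) (h.flow t₀ r x) ∘L h.flowDeriv t₀ r x :=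
  IsCaratheodory.isPrimitive_flow _ t₀ _

theorem tendsto_remainder_flow (t₀ t : ℝ) (x : E) :
    Tendsto (fun y => ‖y - x‖⁻¹ * ‖g t (h.flow t₀ t y) - g t (h.flow t₀ t x) -
      fderiv ℝ (g t) (h.flow t₀ t x) (h.flow t₀ t y - h.flow t₀ t x)‖) (𝓝 x) (𝓝 0) := by
  have hbigO : (fun y => h.flow t₀ t y - h.flow t₀ t x) =O[𝓝 x] fun y => y - x :=
    .of_bound _ (.of_forall fun y => h.norm_flow_sub_flow_le t₀ t y x)
  have hlittleO := ((h.hasFDerivAt t (h.flow t₀ t x)).isLittleO.comp_tendsto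
    ((h.continuous_flow_apply t₀ t).tendsto x)).trans_isBigO hbigO
  simpa only [div_eq_inv_mul, Function.comp_apply] using hlittleO.norm_norm.tendsto_div_nhds_zero

theorem norm_remainder_flow_le (t₀ t : ℝ) (x y : E) :
    ‖y - x‖⁻¹ * ‖g t (h.flow t₀ t y) - g t (h.flow t₀ t x) -
      fderiv ℝ (g t) (h.flow t₀ t x) (h.flow t₀ t y - h.flow t₀ t x)‖ ≤
      4 * (ℓ t * weight ℓ t₀ t) := by
  have hw : 0 ≤ ℓ t * weight ℓ t₀ t := mul_nonneg (h.nonneg t) (weight_pos t₀ t).le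
  have hremainder : ‖g t (h.flow t₀ t y) - g t (h.flow t₀ t x) -
      fderiv ℝ (g t) (h.flow t₀ t x) (h.flow t₀ t y - h.flow t₀ t x)‖ ≤
      ℓ t * (2 * weight ℓ t₀ t * ‖y - x‖) + ℓ t * (2 * weight ℓ t₀ t * ‖y - x‖) := by
    have hflow := mul_le_mul_of_nonneg_left (h.norm_flow_sub_flow_le t₀ t y x) (h.nonneg t)
    refine (norm_sub_le _ _).trans (add_le_add ((h.norm_sub_le t _ _).trans hflow) ?_)
    exact (ContinuousLinearMap.le_of_opNorm_le _ (h.norm_fderiv_le t _) _).trans hflow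
  calc _ ≤ ‖y - x‖⁻¹ * (4 * (ℓ t * weight ℓ t₀ t) * ‖y - x‖) := by
        gcongr
        linarith
    _ = 4 * (ℓ t * weight ℓ t₀ t) * (‖y - x‖⁻¹ * ‖y - x‖) := by ring
    _ ≤ 4 * (ℓ t * weight ℓ t₀ t) :=
        mul_le_of_le_one_right (by linarith) (inv_mul_le_one (a := ‖y - x‖))

theorem hasFDerivAt_flow (t₀ t : ℝ) (x : E) :
    HasFDerivAt (h.flow t₀ t) (h.flowDeriv t₀ t x) x := by
  set Z := fun r => h.flowDeriv t₀ r x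
  set ρ := fun y r => g r (h.flow t₀ r y) - g r (h.flow t₀ r x) -
    fderiv ℝ (g r) (h.flow t₀ r x) (h.flow t₀ r y - h.flow t₀ r x)
  have hφ := h.isPrimitive_flow t₀
  -- The difference quotients vanish at `t₀` and solve the linearized equation up to `ρ`.
  have hquotient : ∀ y, IsPrimitive
      (fun r => ‖y - x‖⁻¹ • (h.flow t₀ r y - h.flow t₀ r x - Z r (y - x)))
      fun r => ‖y - x‖⁻¹ • (g r (h.flow t₀ r y) - g r (h.flow t₀ r x) -
        fderiv ℝ (g r) (h.flow t₀ r x) (Z r (y - x))) := fun y =>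
    (((hφ y).sub (hφ x)).sub ((h.isPrimitive_flowDeriv t₀ x).clm_comp
      (ContinuousLinearMap.apply ℝ E (y - x)))).clm_comp
      (‖y - x‖⁻¹ • ContinuousLinearMap.id ℝ E)
  have hρ : ∀ y, AEStronglyMeasurable fun r => ‖y - x‖⁻¹ * ‖ρ y r‖ := fun y =>
    (((h.aestronglyMeasurable _ (hφ y).continuous).sub
      (h.aestronglyMeasurable _ (hφ x).continuous)).sub
      ((ContinuousLinearMap.id ℝ (E →L[ℝ] E)).aestronglyMeasurable_comp₂
        (h.aestronglyMeasurable_fderiv _ (hφ x).continuous)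
        ((hφ y).continuous.sub (hφ x).continuous).aestronglyMeasurable)).norm.const_mul _
  have hlim := tendsto_zero_of_isPrimitive (t₀ := t₀) hquotient (fun y => by simp [Z])
    h.locallyIntegrable h.nonneg (ε := fun y r => ‖y - x‖⁻¹ * ‖ρ y r‖) (fun y r => ?_)
    (fun y r => by positivity) hρ
    ((locallyIntegrable_mul_weight h.locallyIntegrable t₀).smul (4 : ℝ))
    (fun y r => h.norm_remainder_flow_le t₀ r x y)
    (fun r => h.tendsto_remainder_flow t₀ r x) t
  · have hslice := (hlim.comp ((Continuous.prodMk_right t).tendsto x)).norm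
    simpa [Function.comp_def, norm_smul, hasFDerivAt_iff_tendsto] using hslice
  · have hsplit : g r (h.flow t₀ r y) - g r (h.flow t₀ r x) -
        fderiv ℝ (g r) (h.flow t₀ r x) (Z r (y - x)) =
        fderiv ℝ (g r) (h.flow t₀ r x) (h.flow t₀ r y - h.flow t₀ r x - Z r (y - x)) + ρ y r := by
      simp only [ρ, map_sub]
      abel
    rw [hsplit, smul_add, ← map_smul]
    refine (norm_add_le _ _).trans (add_le_add
      (ContinuousLinearMap.le_of_opNorm_le _ (h.norm_fderiv_le r _) _) ?_)
    rw [norm_smul, norm_inv, norm_norm]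

theorem continuous_flowDeriv (t₀ : ℝ) :
    Continuous fun p : ℝ × E => h.flowDeriv t₀ p.1 p.2 := by
  refine continuous_iff_continuousAt.2 fun ⟨t₁, x⟩ => ?_
  set A := fun y r => fderiv ℝ (g r) (h.flow t₀ r y)
  set Z := fun r => h.flowDeriv t₀ r x
  have hφ := fun y => (h.isPrimitive_flow t₀ y).continuous
  have hZ : Continuous Z := (h.isPrimitive_flowDeriv t₀ x).continuous
  have hA := fun y => h.aestronglyMeasurable_fderiv _ (hφ y)
  have hlim := tendsto_zero_of_isPrimitive (t₀ := t₀)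
    (fun y => (h.isPrimitive_flowDeriv t₀ y).sub (h.isPrimitive_flowDeriv t₀ x))
    (fun y => by simp) h.locallyIntegrable h.nonneg (ε := fun y r => ‖A y r - A x r‖ * ‖Z r‖)
    (y₀ := x) (fun y r => ?_) (fun y r => by positivity)
    (fun y => ((hA y).sub (hA x)).norm.mul hZ.norm.aestronglyMeasurable)
    (h.locallyIntegrable.continuous_mul (continuous_const.mul hZ.norm) (g := fun r => 2 * ‖Z r‖))
    (fun y r => ?_) (fun r => ?_) t₁
  · have hZ₁ : Tendsto (fun p : ℝ × E => Z p.1) (𝓝 (t₁, x)) (𝓝 (Z t₁)) :=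
      (hZ.comp continuous_fst).tendsto (t₁, x)
    simpa [ContinuousAt, Z] using hlim.add hZ₁
  · have hsplit : A y r ∘L h.flowDeriv t₀ r y - A x r ∘L Z r =
        A y r ∘L (h.flowDeriv t₀ r y - Z r) + (A y r - A x r) ∘L Z r := by
      rw [ContinuousLinearMap.comp_sub, ContinuousLinearMap.sub_comp]
      abel
    rw [hsplit]
    exact (norm_add_le _ _).trans (add_le_add ((ContinuousLinearMap.opNorm_comp_le _ _).trans
      (mul_le_mul_of_nonneg_right (h.norm_fderiv_le r _) (norm_nonneg _)))
      (ContinuousLinearMap.opNorm_comp_le _ _))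
  · have hnorm := (norm_sub_le (A y r) (A x r)).trans
      (add_le_add (h.norm_fderiv_le r _) (h.norm_fderiv_le r _))
    calc ‖A y r - A x r‖ * ‖Z r‖ ≤ (ℓ r + ℓ r) * ‖Z r‖ := by gcongr
      _ = 2 * ‖Z r‖ * ℓ r := by ring
  · have hcont : Continuous fun y => ‖A y r - A x r‖ * ‖Z r‖ :=
      ((((h.contDiff r).continuous_fderiv one_ne_zero).comp
        (h.continuous_flow_apply t₀ r)).sub continuous_const).norm.mul continuous_const
    simpa using hcont.tendsto x

theorem contDiff_flow (t₀ t : ℝ) : ContDiff ℝ 1 (h.flow t₀ t) := by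
  have hderiv : fderiv ℝ (h.flow t₀ t) = h.flowDeriv t₀ t :=
    funext fun x => (h.hasFDerivAt_flow t₀ t x).fderiv
  refine contDiff_one_iff_fderiv.2 ⟨fun x => (h.hasFDerivAt_flow t₀ t x).differentiableAt, ?_⟩
  rw [hderiv]
  exact (h.continuous_flowDeriv t₀).comp (Continuous.prodMk_right t)

theorem flowDeriv_comp (r s t : ℝ) (x : E) :
    h.flowDeriv s t (h.flow r s x) ∘L h.flowDeriv r s x = h.flowDeriv r t x := by
  have hcomp := (h.hasFDerivAt_flow s t (h.flow r s x)).comp x (h.hasFDerivAt_flow r s x)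
  rw [funext (h.flow_flow r s t) (f := h.flow s t ∘ h.flow r s)] at hcomp
  exact hcomp.unique (h.hasFDerivAt_flow r t x)

theorem continuous_flowDeriv_symm (t₀ : ℝ) :
    Continuous fun p : ℝ × E => h.flowDeriv p.1 t₀ p.2 := by
  let U : ℝ × E → (E →L[ℝ] E)ˣ := fun p =>
    { val := h.flowDeriv t₀ p.1 (h.flow p.1 t₀ p.2)
      inv := h.flowDeriv p.1 t₀ p.2
      val_inv := by
        simpa only [flowDeriv_self] using! h.flowDeriv_comp p.1 t₀ p.1 p.2
      inv_val := by
        simpa only [IsCaratheodory.flow_flow, IsCaratheodory.flow_self, flowDeriv_self] using!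
          h.flowDeriv_comp t₀ p.1 t₀ (h.flow p.1 t₀ p.2) }
  have hval : Continuous fun p => (U p : E →L[ℝ] E) :=
    (h.continuous_flowDeriv t₀).comp (continuous_fst.prodMk (h.continuous_flow_symm t₀))
  have hinv : (fun p : ℝ × E => h.flowDeriv p.1 t₀ p.2) =
      fun p => Ring.inverse (U p : E →L[ℝ] E) := funext fun p => (Ring.inverse_unit (U p)).symm
  rw [hinv]
  exact continuous_iff_continuousAt.2 fun p =>
    ContinuousAt.comp (f := fun p => (U p : E →L[ℝ] E)) (NormedRing.inverse_continuousAt (U p))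
      hval.continuousAt

theorem det_flowDeriv [FiniteDimensional ℝ E] (t₀ t : ℝ) (x : E) :
    (h.flowDeriv t₀ t x).det =
      Real.exp (∫ r in t₀..t, traceCLM E (fderiv ℝ (g r) (h.flow t₀ r x))) := by
  have hdet := (h.isPrimitive_flowDeriv t₀ x).det_eq
    (h.locallyIntegrable_fderiv (h.isPrimitive_flow t₀ x).continuous) t₀ t
  rw [hdet, flowDeriv_self, show (ContinuousLinearMap.id ℝ E).det = 1 from LinearMap.det_id,
    one_mul]

end IsC1Caratheodory

end Flow

/-! ### First-order equations and their characteristics -/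

section Characteristics

variable {V E F : Type*} [NormedAddCommGroup V] [NormedSpace ℝ V]
  [NormedAddCommGroup E] [NormedSpace ℝ E] [NormedAddCommGroup F] [NormedSpace ℝ F]

/-- A linear family of continuously differentiable vector fields on `E`, indexed by a normed space
`V` whose norm controls, up to the factor `C`, the uniform norm of the fields and of their
derivatives. -/
structure IsC1Family (X : V →ₗ[ℝ] (E → E)) (C : ℝ) : Prop where
  nonneg : 0 ≤ C
  contDiff : ∀ u, ContDiff ℝ 1 (X u)
  norm_le : ∀ u x, ‖X u x‖ ≤ C * ‖u‖
  norm_fderiv_le : ∀ u x, ‖fderiv ℝ (X u) x‖ ≤ C * ‖u‖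

/-- `f` is a time-dependent map that is differentiable in space at the points of `U`, and `f` and
its space derivative are jointly continuous there. -/
structure IsC1InSpace (U : Set E) (f : ℝ → E → F) : Prop where
  differentiableAt : ∀ t, ∀ x ∈ U, DifferentiableAt ℝ (f t) x
  continuousOn : ContinuousOn (fun p : ℝ × E => f p.1 p.2) (univ ×ˢ U)
  continuousOn_fderiv : ContinuousOn (fun p : ℝ × E => fderiv ℝ (f p.1) p.2) (univ ×ˢ U)

namespace IsC1InSpace

variable {U : Set E} {f : ℝ → E → F} (hf : IsC1InSpace U f)

include hf in
theorem continuous_comp {γ : ℝ → E} (hγ : Continuous γ) (hγU : ∀ t, γ t ∈ U) :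
    Continuous fun t => f t (γ t) :=
  hf.continuousOn.comp_continuous (continuous_id.prodMk hγ) fun t => ⟨mem_univ t, hγU t⟩

include hf in
theorem continuous_fderiv_comp {γ : ℝ → E} (hγ : Continuous γ) (hγU : ∀ t, γ t ∈ U) :
    Continuous fun t => fderiv ℝ (f t) (γ t) :=
  hf.continuousOn_fderiv.comp_continuous (continuous_id.prodMk hγ) fun t => ⟨mem_univ t, hγU t⟩

include hf in
theorem exists_local_bound (hU : IsOpen U) (r : ℝ) {x : E} (hx : x ∈ U) :
    ∃ K δ : ℝ, 0 < δ ∧ ∀ t ∈ Metric.ball r δ, ∀ y ∈ Metric.ball x δ,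
      y ∈ U ∧ ‖f t y‖ ≤ K ∧ ‖fderiv ℝ (f t) y‖ ≤ K := by
  have hmem : (univ ×ˢ U : Set (ℝ × E)) ∈ 𝓝 (r, x) :=
    (isOpen_univ.prod hU).mem_nhds ⟨mem_univ r, hx⟩
  have hbound := (hf.continuousOn.continuousAt hmem).norm.eventually_lt_const (lt_add_one _)
  have hbound' := (hf.continuousOn_fderiv.continuousAt hmem).norm.eventually_lt_const (lt_add_one _)
  obtain ⟨δ, hδ, hball⟩ := Metric.eventually_nhds_iff_ball.1 (hbound.and (hbound'.and hmem))
  rw [← ball_prod_same] at hball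
  refine ⟨max (‖f r x‖ + 1) (‖fderiv ℝ (f r) x‖ + 1), δ, hδ, fun t ht y hy => ?_⟩
  obtain ⟨hval, hder, hmem⟩ := hball (t, y) ⟨ht, hy⟩
  exact ⟨hmem.2, hval.le.trans (le_max_left _ _), hder.le.trans (le_max_right _ _)⟩

include hf in
theorem hasDerivAt_comp_sub (hU : IsOpen U) {γ : ℝ → E} {γ' : E} {r : ℝ} (hr : γ r ∈ U)
    (hγ : HasDerivAt γ γ' r) :
    HasDerivAt (fun t => f t (γ t) - f t (γ r)) (fderiv ℝ (f r) (γ r) γ') r := by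
  suffices hrem : (fun t => f t (γ t) - f t (γ r) - fderiv ℝ (f r) (γ r) (γ t - γ r)) =o[𝓝 r]
      fun t => t - r by
    have hlin := (fderiv ℝ (f r) (γ r)).hasFDerivAt.comp_hasDerivAt r (hγ.sub_const (γ r))
    rw [hasDerivAt_iff_isLittleO] at hlin ⊢
    refine (hrem.add hlin).congr_left fun t => ?_
    simp only [Function.comp_apply, sub_self, map_zero, sub_zero]
    abel
  have hmem : (univ ×ˢ U : Set (ℝ × E)) ∈ 𝓝 (r, γ r) :=
    (isOpen_univ.prod hU).mem_nhds ⟨mem_univ r, hr⟩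
  have hder := Metric.continuousAt_iff'.1 (hf.continuousOn_fderiv.continuousAt hmem)
  refine Asymptotics.IsLittleO.trans_isBigO (Asymptotics.isLittleO_iff.2 fun ε hε => ?_)
    hγ.isBigO_sub
  obtain ⟨δ, hδ, hball⟩ := Metric.eventually_nhds_iff_ball.1 ((hder ε hε).and hmem)
  rw [← ball_prod_same] at hball
  filter_upwards [Metric.ball_mem_nhds r hδ,
    hγ.continuousAt.preimage_mem_nhds (Metric.ball_mem_nhds (γ r) hδ)] with t ht hγt
  refine (convex_ball (γ r) δ).norm_image_sub_le_of_norm_fderiv_le'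
    (fun y hy => hf.differentiableAt t y (hball (t, y) ⟨ht, hy⟩).2.2) (fun y hy => ?_)
    (Metric.mem_ball_self hδ) hγt
  rw [← dist_eq_norm]
  exact (hball (t, y) ⟨ht, hy⟩).1.le

end IsC1InSpace

namespace IsC1Family

variable {X : V →ₗ[ℝ] (E → E)} {C : ℝ} (h : IsC1Family X C)

/-- The derivative of `X u` at `x`, as a linear function of `u`. -/
def fderivLM (x : E) : V →ₗ[ℝ] (E →L[ℝ] E) where
  toFun u := fderiv ℝ (X u) x
  map_add' u w := by
    rw [map_add, fderiv_add ((h.contDiff u).differentiable one_ne_zero x)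
      ((h.contDiff w).differentiable one_ne_zero x)]
  map_smul' c u := by
    rw [map_smul, fderiv_const_smul ((h.contDiff u).differentiable one_ne_zero x), RingHom.id_apply]

theorem fderivLM_apply (x : E) (u : V) : h.fderivLM x u = fderiv ℝ (X u) x := rfl

include h in
theorem norm_apply_sub_apply_le (u : V) (x y : E) : ‖X u x - X u y‖ ≤ C * ‖u‖ * ‖x - y‖ :=
  convex_univ.norm_image_sub_le_of_norm_fderiv_le
    (fun z _ => (h.contDiff u).differentiable one_ne_zero z) (fun z _ => h.norm_fderiv_le u z)
    (mem_univ y) (mem_univ x)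

include h in
theorem continuous_eval : Continuous fun p : V × E => X p.1 p.2 := by
  refine continuous_prod_of_continuous_lipschitzWith _ C.toNNReal
    (fun u => (h.contDiff u).continuous) fun x => LipschitzWith.of_dist_le' fun u w => ?_
  rw [dist_eq_norm, dist_eq_norm, ← Pi.sub_apply, ← map_sub]
  exact h.norm_le (u - w) x

include h in
theorem continuous_fderiv : Continuous fun p : V × E => fderiv ℝ (X p.1) p.2 := by
  refine continuous_prod_of_continuous_lipschitzWith _ C.toNNReal
    (fun u => (h.contDiff u).continuous_fderiv one_ne_zero) fun x =>
      LipschitzWith.of_dist_le' fun u w => ?_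
  rw [dist_eq_norm, dist_eq_norm, ← h.fderivLM_apply, ← h.fderivLM_apply, ← map_sub]
  exact h.norm_fderiv_le (u - w) x

include h in
theorem isC1Caratheodory {v : ℝ → V} (hv : LocallyIntegrable v) :
    IsC1Caratheodory (fun t => X (v t)) fun t => C * ‖v t‖ where
  locallyIntegrable := (locallyIntegrable_norm hv).smul C
  nonneg _ := mul_nonneg h.nonneg (norm_nonneg _)
  norm_sub_le t := h.norm_apply_sub_apply_le (v t)
  norm_zero_le t := h.norm_le (v t) 0
  aestronglyMeasurable _ hγ := h.continuous_eval.comp_aestronglyMeasurable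
    (hv.aestronglyMeasurable.prodMk hγ.aestronglyMeasurable)
  contDiff t := h.contDiff (v t)
  aestronglyMeasurable_fderiv _ hγ := h.continuous_fderiv.comp_aestronglyMeasurable
    (hv.aestronglyMeasurable.prodMk hγ.aestronglyMeasurable)

section Rates

variable (q : (E →L[ℝ] E) →L[ℝ] ℝ) (f : ℝ → E → F)

/-- The rate of change of a solution of `∂ₜ f + Df(X u) + q(D(X u)) f = 0` seen by an observer who
moves with the field `X u`, as a linear function of `u`. -/
def lagrangianRate (t : ℝ) (x : E) : V →ₗ[ℝ] F :=
  -(((q : (E →L[ℝ] E) →ₗ[ℝ] ℝ) ∘ₗ h.fderivLM x).smulRight (f t x))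

/-- The rate of change of a solution of `∂ₜ f + Df(X u) + q(D(X u)) f = 0` at a fixed point of
space, as a linear function of `u`. -/
def eulerianRate (t : ℝ) (x : E) : V →ₗ[ℝ] F :=
  h.lagrangianRate q f t x - (fderiv ℝ (f t) x : E →ₗ[ℝ] F) ∘ₗ LinearMap.proj x ∘ₗ X

theorem lagrangianRate_apply (t : ℝ) (x : E) (u : V) :
    h.lagrangianRate q f t x u = -(q (fderiv ℝ (X u) x) • f t x) := rfl

theorem eulerianRate_apply (t : ℝ) (x : E) (u : V) :
    h.eulerianRate q f t x u = h.lagrangianRate q f t x u - fderiv ℝ (f t) x (X u x) := rfl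

variable {f} {U : Set E} (hf : IsC1InSpace U f)

include hf in
theorem continuous_lagrangianRate {γ : ℝ → E} (hγ : Continuous γ) (hγU : ∀ t, γ t ∈ U) :
    Continuous fun p : ℝ × V => h.lagrangianRate q f p.1 (γ p.1) p.2 :=
  ((q.continuous.comp (h.continuous_fderiv.comp
    (continuous_snd.prodMk (hγ.comp continuous_fst)))).smul
      ((hf.continuous_comp hγ hγU).comp continuous_fst)).neg

include hf in
theorem continuous_eulerianRate {x : E} (hx : x ∈ U) :
    Continuous fun p : ℝ × V => h.eulerianRate q f p.1 x p.2 :=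
  (h.continuous_lagrangianRate q hf continuous_const fun _ => hx).sub
    (((hf.continuous_fderiv_comp continuous_const fun _ => hx).comp continuous_fst).clm_apply
      (h.continuous_eval.comp (continuous_snd.prodMk continuous_const)))

variable (f) in
theorem norm_lagrangianRate_le (t : ℝ) (x : E) (u : V) :
    ‖h.lagrangianRate q f t x u‖ ≤ ‖q‖ * C * ‖f t x‖ * ‖u‖ := by
  rw [lagrangianRate_apply, norm_neg, norm_smul]
  calc ‖q (fderiv ℝ (X u) x)‖ * ‖f t x‖ ≤ ‖q‖ * (C * ‖u‖) * ‖f t x‖ := by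
        gcongr; exact q.le_opNorm_of_le (h.norm_fderiv_le u x)
    _ = ‖q‖ * C * ‖f t x‖ * ‖u‖ := by ring

variable (f) in
theorem norm_eulerianRate_le (t : ℝ) (x : E) (u : V) :
    ‖h.eulerianRate q f t x u‖ ≤ (‖q‖ * C * ‖f t x‖ + C * ‖fderiv ℝ (f t) x‖) * ‖u‖ := by
  have hmove : ‖fderiv ℝ (f t) x (X u x)‖ ≤ ‖fderiv ℝ (f t) x‖ * (C * ‖u‖) :=
    (fderiv ℝ (f t) x).le_opNorm_of_le (h.norm_le u x)
  rw [eulerianRate_apply]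
  linarith [norm_sub_le (h.lagrangianRate q f t x u) (fderiv ℝ (f t) x (X u x)),
    h.norm_lagrangianRate_le q f t x u]

include hf in
theorem exists_local_rate_bound (hU : IsOpen U) (r : ℝ) {x : E} (hx : x ∈ U) :
    ∃ K δ : ℝ, 0 ≤ K ∧ 0 < δ ∧ ∀ t ∈ Metric.ball r δ, ∀ y ∈ Metric.ball x δ,
      y ∈ U ∧ ‖fderiv ℝ (f t) y‖ ≤ K ∧ ∀ u, ‖h.lagrangianRate q f t y u‖ ≤ K * ‖u‖ ∧
        ‖h.eulerianRate q f t y u‖ ≤ K * ‖u‖ := by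
  obtain ⟨K, δ, hδ, hK⟩ := hf.exists_local_bound hU r hx
  have hC := h.nonneg
  have hK0 : 0 ≤ K :=
    (norm_nonneg _).trans (hK r (Metric.mem_ball_self hδ) x (Metric.mem_ball_self hδ)).2.1
  refine ⟨‖q‖ * C * K + C * K + K, δ, by positivity, hδ, fun t ht y hy => ?_⟩
  obtain ⟨hyU, hval, hder⟩ := hK t ht y hy
  have hq : ‖q‖ * C * ‖f t y‖ ≤ ‖q‖ * C * K := by gcongr
  have hX : C * ‖fderiv ℝ (f t) y‖ ≤ C * K := by gcongr
  have hCK : 0 ≤ C * K := by positivity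
  have hqCK : 0 ≤ ‖q‖ * C * K := by positivity
  refine ⟨hyU, by linarith, fun u => ⟨(h.norm_lagrangianRate_le q f t y u).trans ?_,
    (h.norm_eulerianRate_le q f t y u).trans ?_⟩⟩ <;>
  exact mul_le_mul_of_nonneg_right (by linarith) (norm_nonneg u)

end Rates

section Flow

variable [CompleteSpace E] {v : ℝ → V} (hv : LocallyIntegrable v)

/-- The flow of the time-dependent field `X (v t)`. -/
def flow (t₀ t : ℝ) (x : E) : E := (h.isC1Caratheodory hv).flow t₀ t x

@[simp]
theorem flow_self (t₀ : ℝ) (x : E) : h.flow hv t₀ t₀ x = x :=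
  (h.isC1Caratheodory hv).flow_self t₀ x

theorem flow_flow (r s t : ℝ) (x : E) : h.flow hv s t (h.flow hv r s x) = h.flow hv r t x :=
  (h.isC1Caratheodory hv).flow_flow r s t x

theorem isPrimitive_flow (t₀ : ℝ) (x : E) :
    IsPrimitive (fun t => h.flow hv t₀ t x) fun t => X (v t) (h.flow hv t₀ t x) :=
  (h.isC1Caratheodory hv).isPrimitive_flow t₀ x

theorem continuous_flow_time (t₀ : ℝ) (y : E) : Continuous fun t => h.flow hv t₀ t y :=
  (h.isPrimitive_flow hv t₀ y).continuous

theorem hasDerivAt_flow {r : ℝ} (hr : IsLebesguePoint v r) (t₀ : ℝ) (y : E) :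
    HasDerivAt (fun t => h.flow hv t₀ t y) (X (v r) (h.flow hv t₀ r y)) r :=
  hr.hasDerivAt_of_isPrimitive hv (L := fun s => LinearMap.proj (h.flow hv t₀ s y) ∘ₗ X)
    (h.continuous_eval.comp
      (continuous_snd.prodMk ((h.continuous_flow_time hv t₀ y).comp continuous_fst)))
    (h.isPrimitive_flow hv t₀ y)

theorem norm_flow_sub_le (t₀ s t : ℝ) (y : E) :
    ‖h.flow hv t₀ t y - h.flow hv t₀ s y‖ ≤ C * |∫ r in s..t, ‖v r‖| := by
  rw [(h.isPrimitive_flow hv t₀ y).2]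
  exact norm_integral_le_mul_abs_integral h.nonneg (locallyIntegrable_norm hv)
    fun r _ => h.norm_le (v r) _

theorem eventually_flow_mem_ball (r : ℝ) (x : E) {δ : ℝ} (hδ : 0 < δ) :
    ∀ᶠ p : ℝ × ℝ in 𝓝 (r, r), ∀ t ∈ uIcc p.1 p.2, h.flow hv p.1 t x ∈ Metric.ball x δ := by
  have hP := isPrimitive_integral (locallyIntegrable_norm hv) r
  have hcont : Continuous fun p : ℝ × ℝ =>
      C * |(∫ t in r..p.2, ‖v t‖) - ∫ t in r..p.1, ‖v t‖| :=
    continuous_const.mul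
      ((hP.continuous.comp continuous_snd).sub (hP.continuous.comp continuous_fst)).abs
  have hlim := hcont.tendsto (r, r)
  simp only [sub_self, abs_zero, mul_zero] at hlim
  obtain ⟨ε, hε, hball⟩ := Metric.eventually_nhds_iff_ball.1 (hlim.eventually_lt_const hδ)
  rw [← ball_prod_same] at hball
  filter_upwards [prod_mem_nhds (Metric.ball_mem_nhds r hε) (Metric.ball_mem_nhds r hε)]
    with p hp t ht
  have ht' : t ∈ Metric.ball r ε := (convex_ball r ε).ordConnected.uIcc_subset hp.1 hp.2 ht
  have hle := h.norm_flow_sub_le hv p.1 p.1 t x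
  rw [flow_self, ← hP.2] at hle
  rw [mem_ball_iff_norm]
  exact hle.trans_lt (hball (p.1, t) ⟨hp.1, ht'⟩)

variable (q : (E →L[ℝ] E) →L[ℝ] ℝ) {f : ℝ → E → F} {U : Set E}

theorem exists_local_increment_le_of_eulerian (hU : IsOpen U) (hf : IsC1InSpace U f)
    (heul : ∀ x ∈ U, IsPrimitive (fun t => f t x) fun t => h.eulerianRate q f t x (v t))
    {t₀ r : ℝ} {y : E} (hy : h.flow hv t₀ r y ∈ U) :
    ∃ K, ∀ᶠ p : ℝ × ℝ in 𝓝 (r, r), ‖f p.2 (h.flow hv t₀ p.2 y) - f p.1 (h.flow hv t₀ p.1 y)‖ ≤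
      K * |∫ t in p.1..p.2, ‖v t‖| := by
  obtain ⟨K, δ, hK0, hδ, hK⟩ := h.exists_local_rate_bound q hf hU r hy
  have htime := Metric.ball_mem_nhds r hδ
  have hspace : (fun t => h.flow hv t₀ t y) ⁻¹' Metric.ball (h.flow hv t₀ r y) δ ∈ 𝓝 r :=
    (h.continuous_flow_time hv t₀ y).continuousAt.preimage_mem_nhds (Metric.ball_mem_nhds _ hδ)
  refine ⟨K * C + K, ?_⟩
  filter_upwards [prod_mem_nhds (inter_mem htime hspace) (inter_mem htime hspace)]
    with ⟨s, t⟩ ⟨⟨hs, hγs⟩, ht, hγt⟩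
  have hmove : ‖f t (h.flow hv t₀ t y) - f t (h.flow hv t₀ s y)‖ ≤
      K * (C * |∫ τ in s..t, ‖v τ‖|) :=
    ((convex_ball _ δ).norm_image_sub_le_of_norm_fderiv_le
      (fun z hz => hf.differentiableAt t z (hK t ht z hz).1) (fun z hz => (hK t ht z hz).2.1)
      hγs hγt).trans (mul_le_mul_of_nonneg_left (h.norm_flow_sub_le hv t₀ s t y) hK0)
  have hstay : ‖f t (h.flow hv t₀ s y) - f s (h.flow hv t₀ s y)‖ ≤ K * |∫ τ in s..t, ‖v τ‖| := by
    rw [(heul _ (hK s hs _ hγs).1).2]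
    refine norm_integral_le_mul_abs_integral hK0 (locallyIntegrable_norm hv) fun τ hτ => ?_
    exact ((hK τ ((convex_ball r δ).ordConnected.uIcc_subset hs ht hτ) _ hγs).2.2 (v τ)).2
  linarith [norm_sub_le_norm_sub_add_norm_sub (f t (h.flow hv t₀ t y))
    (f t (h.flow hv t₀ s y)) (f s (h.flow hv t₀ s y))]

theorem exists_local_increment_le_of_lagrangian (hU : IsOpen U) (hf : IsC1InSpace U f)
    (hflow : ∀ s t, ∀ x ∈ U, h.flow hv s t x ∈ U) {t₀ : ℝ}
    (hlag : ∀ y ∈ U, IsPrimitive (fun t => f t (h.flow hv t₀ t y))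
      fun t => h.lagrangianRate q f t (h.flow hv t₀ t y) (v t))
    (r : ℝ) {x : E} (hx : x ∈ U) :
    ∃ K, ∀ᶠ p : ℝ × ℝ in 𝓝 (r, r), ‖f p.2 x - f p.1 x‖ ≤ K * |∫ t in p.1..p.2, ‖v t‖| := by
  obtain ⟨K, δ, hK0, hδ, hK⟩ := h.exists_local_rate_bound q hf hU r hx
  have htime := Metric.ball_mem_nhds r hδ
  refine ⟨K * C + K, ?_⟩
  filter_upwards [prod_mem_nhds htime htime, h.eventually_flow_mem_ball hv r x hδ]
    with ⟨s, t⟩ ⟨hs, ht⟩ hball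
  have hmove : ‖f t (h.flow hv s t x) - f t x‖ ≤ K * (C * |∫ τ in s..t, ‖v τ‖|) := by
    have hdist := h.norm_flow_sub_le hv s s t x
    rw [flow_self] at hdist
    exact ((convex_ball x δ).norm_image_sub_le_of_norm_fderiv_le
      (fun z hz => hf.differentiableAt t z (hK t ht z hz).1) (fun z hz => (hK t ht z hz).2.1)
      (Metric.mem_ball_self hδ) (hball t right_mem_uIcc)).trans
        (mul_le_mul_of_nonneg_left hdist hK0)
  have hfollow : ‖f t (h.flow hv s t x) - f s x‖ ≤ K * |∫ τ in s..t, ‖v τ‖| := by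
    have hinc := (hlag (h.flow hv s t₀ x) (hflow s t₀ x hx)).2 s t
    simp only [flow_flow, flow_self] at hinc
    rw [hinc]
    refine norm_integral_le_mul_abs_integral hK0 (locallyIntegrable_norm hv) fun τ hτ => ?_
    exact ((hK τ ((convex_ball r δ).ordConnected.uIcc_subset hs ht hτ) _ (hball τ hτ)).2.2 _).1
  calc ‖f t x - f s x‖ ≤ ‖f t x - f t (h.flow hv s t x)‖ + ‖f t (h.flow hv s t x) - f s x‖ :=
        norm_sub_le_norm_sub_add_norm_sub _ _ _
    _ ≤ (K * C + K) * |∫ τ in s..t, ‖v τ‖| := by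
        rw [norm_sub_rev (f t x)]
        linarith

theorem isPrimitive_lagrangianRate_of_eulerian [CompleteSpace F] (hU : IsOpen U)
    (hf : IsC1InSpace U f)
    (heul : ∀ x ∈ U, IsPrimitive (fun t => f t x) fun t => h.eulerianRate q f t x (v t))
    {t₀ : ℝ} {y : E} (hy : ∀ t, h.flow hv t₀ t y ∈ U) :
    IsPrimitive (fun t => f t (h.flow hv t₀ t y))
      fun t => h.lagrangianRate q f t (h.flow hv t₀ t y) (v t) := by
  refine isPrimitive_of_ae_hasDerivAt (k := fun t => ‖v t‖) (locallyIntegrable_apply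
      (h.continuous_lagrangianRate q hf (h.continuous_flow_time hv t₀ y) hy) hv)
    (locallyIntegrable_norm hv)
    (fun r => h.exists_local_increment_le_of_eulerian hv q hU hf heul (hy r)) ?_
  filter_upwards [ae_isLebesguePoint hv] with r hr
  have hmove := hf.hasDerivAt_comp_sub hU (γ := fun t => h.flow hv t₀ t y) (hy r)
    (h.hasDerivAt_flow hv hr t₀ y)
  have hstay := hr.hasDerivAt_of_isPrimitive hv (h.continuous_eulerianRate q hf (hy r))
    (heul _ (hy r))
  convert hstay.add hmove using 1
  · ext t; simp
  · rw [eulerianRate_apply, sub_add_cancel]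

theorem isPrimitive_eulerianRate_of_lagrangian [CompleteSpace F] (hU : IsOpen U)
    (hf : IsC1InSpace U f) (hflow : ∀ s t, ∀ x ∈ U, h.flow hv s t x ∈ U) {t₀ : ℝ}
    (hlag : ∀ y ∈ U, IsPrimitive (fun t => f t (h.flow hv t₀ t y))
      fun t => h.lagrangianRate q f t (h.flow hv t₀ t y) (v t)) {x : E} (hx : x ∈ U) :
    IsPrimitive (fun t => f t x) fun t => h.eulerianRate q f t x (v t) := by
  refine isPrimitive_of_ae_hasDerivAt (k := fun t => ‖v t‖)
    (locallyIntegrable_apply (h.continuous_eulerianRate q hf hx) hv) (locallyIntegrable_norm hv)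
    (fun r => h.exists_local_increment_le_of_lagrangian hv q hU hf hflow hlag r hx) ?_
  filter_upwards [ae_isLebesguePoint hv] with r hr
  set y := h.flow hv r t₀ x with hy
  have hyU : ∀ t, h.flow hv t₀ t y ∈ U := fun t => hflow t₀ t y (hflow r t₀ x hx)
  have hmove := hf.hasDerivAt_comp_sub hU (γ := fun t => h.flow hv t₀ t y) (hyU r)
    (h.hasDerivAt_flow hv hr t₀ y)
  have hfollow := hr.hasDerivAt_of_isPrimitive hv
    (h.continuous_lagrangianRate q hf (h.continuous_flow_time hv t₀ y) hyU)
    (hlag y (hflow r t₀ x hx))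
  simp only [hy, flow_flow, flow_self] at hmove hfollow
  convert hfollow.sub hmove using 1
  · ext t; simp
  · rw [eulerianRate_apply]

theorem locallyIntegrable_fderiv_flow (t₀ : ℝ) (y : E) :
    LocallyIntegrable fun t => q (fderiv ℝ (X (v t)) (h.flow hv t₀ t y)) :=
  locallyIntegrable_clm_comp ((h.isC1Caratheodory hv).locallyIntegrable_fderiv
    (h.continuous_flow_time hv t₀ y)) q

/-- The method of characteristics: along the flow, a first-order equation becomes a scalar linear
equation, which is solved by an exponential. -/
theorem isPrimitive_eulerianRate_iff {f : ℝ → E → ℝ} (hU : IsOpen U) (hf : IsC1InSpace U f)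
    (hflow : ∀ s t, ∀ x ∈ U, h.flow hv s t x ∈ U) (t₀ : ℝ) :
    (∀ x ∈ U, IsPrimitive (fun t => f t x) fun t => h.eulerianRate q f t x (v t)) ↔
      ∀ y ∈ U, ∀ t, f t (h.flow hv t₀ t y) =
        f t₀ y * Real.exp (-∫ r in t₀..t, q (fderiv ℝ (X (v r)) (h.flow hv t₀ r y))) := by
  have hexp : ∀ y, IsPrimitive (fun t => f t (h.flow hv t₀ t y))
      (fun t => h.lagrangianRate q f t (h.flow hv t₀ t y) (v t)) ↔
      ∀ t, f t (h.flow hv t₀ t y) =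
        f t₀ y * Real.exp (-∫ r in t₀..t, q (fderiv ℝ (X (v r)) (h.flow hv t₀ r y))) := by
    intro y
    simpa only [lagrangianRate_apply, smul_eq_mul, neg_mul, flow_self, Pi.neg_apply,
      intervalIntegral.integral_neg] using! isPrimitive_iff_eq_mul_exp_integral
        (γ := fun t => f t (h.flow hv t₀ t y)) (h.locallyIntegrable_fderiv_flow hv q t₀ y).neg t₀
  simp only [← hexp]
  exact ⟨fun heul y hy => h.isPrimitive_lagrangianRate_of_eulerian hv q hU hf heul
      fun t => hflow t₀ t y hy,
    fun hlag x hx => h.isPrimitive_eulerianRate_of_lagrangian hv q hU hf hflow hlag hx⟩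

end Flow

end IsC1Family

end Characteristics

/-! ### Extension by zero in space -/

section ExtendZero

variable {n : ℕ} {Ω : TopologicalSpace.Opens (Euc n)} {F : Type*}

theorem extendZero_of_mem [Zero F] (u : Ω → F) {x : Euc n} (hx : x ∈ Ω) :
    extendZero u x = u ⟨x, hx⟩ := dif_pos hx

theorem extendZero_coe [Zero F] (u : Ω → F) (x : Ω) : extendZero u x = u x := dif_pos x.2

theorem extendZero_of_notMem [Zero F] (u : Ω → F) {x : Euc n} (hx : x ∉ Ω) :
    extendZero u x = 0 := dif_neg hx

theorem extendZero_eventuallyEq [Zero F] {u : Ω → F} {w : Euc n → F} (h : ∀ x : Ω, u x = w x)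
    (x : Ω) : extendZero u =ᶠ[𝓝 (x : Euc n)] w := by
  filter_upwards [Ω.isOpen.mem_nhds x.2] with y hy
  exact (extendZero_of_mem u hy).trans (h ⟨y, hy⟩)

variable [NormedAddCommGroup F]

theorem norm_extendZero_le {u : Ω → F} {M : ℝ} (hM : 0 ≤ M) (h : ∀ x, ‖u x‖ ≤ M) (x : Euc n) :
    ‖extendZero u x‖ ≤ M := by
  by_cases hx : x ∈ Ω
  · exact (extendZero_of_mem u hx).symm ▸ h ⟨x, hx⟩
  · rwa [extendZero_of_notMem u hx, norm_zero]

theorem exists_isCompact_norm_extendZero_lt {u : Ω → F} (hu : Tendsto u (cocompact Ω) (𝓝 0))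
    {ε : ℝ} (hε : 0 < ε) :
    ∃ K : Set (Euc n), IsCompact K ∧ K ⊆ Ω ∧ ∀ x ∉ K, ‖extendZero u x‖ < ε := by
  obtain ⟨K, hK, hKu⟩ := mem_cocompact.1 (hu (Metric.ball_mem_nhds 0 hε))
  refine ⟨(↑) '' K, hK.image continuous_subtype_val, by rintro _ ⟨x, -, rfl⟩; exact x.2,
    fun x hx => ?_⟩
  by_cases hxΩ : x ∈ Ω
  · rw [extendZero_of_mem u hxΩ]
    have hxK : (⟨x, hxΩ⟩ : Ω) ∈ Kᶜ := fun h => hx ⟨_, h, rfl⟩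
    simpa using hKu hxK
  · rwa [extendZero_of_notMem u hxΩ, norm_zero]

theorem eventually_norm_extendZero_lt {u : Ω → F} (hu : Tendsto u (cocompact Ω) (𝓝 0))
    {x : Euc n} (hx : x ∉ Ω) {ε : ℝ} (hε : 0 < ε) : ∀ᶠ y in 𝓝 x, ‖extendZero u y‖ < ε := by
  obtain ⟨K, hK, hKΩ, hKε⟩ := exists_isCompact_norm_extendZero_lt hu hε
  filter_upwards [hK.isClosed.isOpen_compl.mem_nhds fun h => hx (hKΩ h)] with y hy
  exact hKε y hy

theorem continuous_extendZero {u : Ω → F} (hu : Continuous u)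
    (hu₀ : Tendsto u (cocompact Ω) (𝓝 0)) : Continuous (extendZero u) := by
  refine continuous_iff_continuousAt.2 fun x => ?_
  by_cases hx : x ∈ Ω
  · refine (Ω.isOpen.isOpenEmbedding_subtypeVal.continuousAt_iff (x := ⟨x, hx⟩)).1 ?_
    exact (hu.congr fun y => (extendZero_coe u y).symm).continuousAt
  · refine Metric.tendsto_nhds.2 fun ε hε => ?_
    simpa only [extendZero_of_notMem u hx, dist_zero_right]
      using eventually_norm_extendZero_lt hu₀ hx hε

variable [NormedSpace ℝ F]

theorem IsC1.hasFDerivAt {u : Ω → F} (hu : IsC1 u) (x : Ω) :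
    HasFDerivAt (extendZero u) (jac u x) (x : Euc n) :=
  ((hu.differentiableOn one_ne_zero).differentiableAt (Ω.isOpen.mem_nhds x.2)).hasFDerivAt

theorem IsC1.continuous {u : Ω → F} (hu : IsC1 u) : Continuous u :=
  (continuousOn_iff_continuous_domRestrict.1 hu.continuousOn).congr (extendZero_coe u)

theorem IsC1.continuous_jac {u : Ω → F} (hu : IsC1 u) : Continuous (jac u) :=
  continuousOn_iff_continuous_domRestrict.1
    (hu.continuousOn_fderiv_of_isOpen Ω.isOpen le_rfl)

theorem isC1_of_contDiff {u : Ω → F} {w : Euc n → F} (hw : ContDiff ℝ 1 w)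
    (h : ∀ x : Ω, u x = w x) : IsC1 u :=
  hw.contDiffOn.congr fun x hx => (extendZero_of_mem u hx).trans (h ⟨x, hx⟩)

theorem jac_eq_of_hasFDerivAt {u : Ω → F} {w : Euc n → F} {w' : Euc n →L[ℝ] F} {x : Ω}
    (hw : HasFDerivAt w w' x) (h : ∀ x : Ω, u x = w x) : jac u x = w' :=
  (hw.congr_of_eventuallyEq (extendZero_eventuallyEq h x)).fderiv

theorem norm_extendZero_le_of_segment {u : Ω → F} (hu : IsC1 u)
    (hu₀ : Tendsto u (cocompact Ω) (𝓝 0)) {x y : Euc n} (hy : y ∉ Ω) {ε : ℝ} (hε : 0 ≤ ε)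
    (hjac : ∀ z ∈ segment ℝ x y, ‖extendZero (jac u) z‖ ≤ ε) :
    ‖extendZero u x‖ ≤ ε * ‖y - x‖ := by
  let c : ℝ → Euc n := AffineMap.lineMap x y
  have hc : Continuous c := AffineMap.lineMap_continuous
  let S : Set ℝ := Icc 0 1 ∩ c ⁻¹' (Ω : Set (Euc n))ᶜ
  have hS : IsCompact S := isCompact_Icc.inter_right (Ω.isOpen.isClosed_compl.preimage hc)
  have hexit : sInf S ∈ S :=
    hS.sInf_mem ⟨1, ⟨zero_le_one, le_rfl⟩, by simpa [c] using hy⟩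
  have hinside : ∀ r ∈ Ico 0 (sInf S), c r ∈ Ω := fun r hr => by
    by_contra hn
    exact notMem_of_lt_csInf hr.2 hS.bddBelow ⟨⟨hr.1, hr.2.le.trans hexit.1.2⟩, hn⟩
  have hmean := norm_image_sub_le_of_norm_deriv_right_le_segment (a := 0) (b := sInf S)
    (f := extendZero u ∘ c) (f' := fun r => extendZero (jac u) (c r) (y - x))
    (C := ε * ‖y - x‖) ((continuous_extendZero hu.continuous hu₀).comp hc).continuousOn
    (fun r hr => ?_) (fun r hr => ?_) (sInf S) ⟨hexit.1.1, le_rfl⟩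
  · have hend : (extendZero u ∘ c) (sInf S) = 0 := extendZero_of_notMem u hexit.2
    have hstart : (extendZero u ∘ c) 0 = extendZero u x := by simp [c]
    rw [hend, hstart, zero_sub, norm_neg, sub_zero] at hmean
    exact hmean.trans (mul_le_of_le_one_right (by positivity) hexit.1.2)
  · rw [extendZero_of_mem (jac u) (hinside r hr)]
    exact ((hu.hasFDerivAt ⟨c r, hinside r hr⟩).comp_hasDerivAt r
      AffineMap.hasDerivAt_lineMap).hasDerivWithinAt
  · refine (ContinuousLinearMap.le_opNorm _ _).trans
      (mul_le_mul_of_nonneg_right (hjac _ ?_) (norm_nonneg _))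
    rw [segment_eq_image_lineMap]
    exact ⟨r, ⟨hr.1, hr.2.le.trans hexit.1.2⟩, rfl⟩

end ExtendZero

namespace IsC1Zero

variable {n : ℕ} {Ω : TopologicalSpace.Opens (Euc n)} {u : Ω → Euc n}

theorem hasFDerivAt_extendZero (hu : IsC1Zero u) (x : Euc n) :
    HasFDerivAt (extendZero u) (extendZero (jac u) x) x := by
  by_cases hx : x ∈ Ω
  · rw [extendZero_of_mem _ hx]
    exact hu.1.hasFDerivAt ⟨x, hx⟩
  rw [extendZero_of_notMem _ hx]
  refine .of_isLittleO (Asymptotics.isLittleO_iff.2 fun ε hε => ?_)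
  obtain ⟨r, hr, hjac⟩ := Metric.eventually_nhds_iff_ball.1
    (eventually_norm_extendZero_lt hu.2.2 hx hε)
  filter_upwards [Metric.ball_mem_nhds x hr] with y hy
  rw [extendZero_of_notMem u hx, sub_zero, zero_apply, sub_zero, norm_sub_rev]
  exact norm_extendZero_le_of_segment hu.1 hu.2.1 hx hε.le fun z hz =>
    (hjac z ((convex_ball x r).segment_subset hy (Metric.mem_ball_self hr) hz)).le

theorem fderiv_extendZero (hu : IsC1Zero u) : fderiv ℝ (extendZero u) = extendZero (jac u) :=
  funext fun x => (hu.hasFDerivAt_extendZero x).fderiv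

theorem contDiff_extendZero (hu : IsC1Zero u) : ContDiff ℝ 1 (extendZero u) := by
  refine contDiff_one_iff_fderiv.2 ⟨fun x => (hu.hasFDerivAt_extendZero x).differentiableAt, ?_⟩
  rw [hu.fderiv_extendZero]
  exact continuous_extendZero hu.1.continuous_jac hu.2.2

end IsC1Zero

section Admissible

variable {n : ℕ} {Ω : TopologicalSpace.Opens (Euc n)}
  {V : Type*} [NormedAddCommGroup V] [InnerProductSpace ℝ V]

/-- The vector fields of the family `ev`, extended by zero to the whole space, where their flows
are defined without leaving the domain. -/
def extendedField (ev : V →ₗ[ℝ] (Ω → Euc n)) : V →ₗ[ℝ] (Euc n → Euc n) where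
  toFun u := extendZero (ev u)
  map_add' u w := by
    ext1 x
    by_cases hx : x ∈ Ω <;> simp [extendZero, hx]
  map_smul' c u := by
    ext1 x
    by_cases hx : x ∈ Ω <;> simp [extendZero, hx]

theorem extendedField_apply (ev : V →ₗ[ℝ] (Ω → Euc n)) (u : V) :
    extendedField ev u = extendZero (ev u) := rfl

theorem IsAdmissible.exists_isC1Family {ev : V →ₗ[ℝ] (Ω → Euc n)} (hV : IsAdmissible ev) :
    ∃ C, IsC1Family (extendedField ev) C := by
  obtain ⟨C, hC, hbound⟩ := hV.bound
  have hnonneg : ∀ u : V, 0 ≤ C * ‖u‖ := fun u => mul_nonneg hC.le (norm_nonneg _)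
  refine ⟨C, hC.le, fun u => (hV.isC1Zero u).contDiff_extendZero, fun u => ?_, fun u => ?_⟩
  · exact norm_extendZero_le (hnonneg u) fun x =>
      (le_add_of_nonneg_right (norm_nonneg _)).trans (hbound u x x)
  · rw [extendedField_apply, (hV.isC1Zero u).fderiv_extendZero]
    exact norm_extendZero_le (hnonneg u) fun x =>
      (le_add_of_nonneg_left (norm_nonneg _)).trans (hbound u x x)

end Admissible

/-! ### Time on the unit interval and on the real line -/

section Time

variable {F : Type*} [NormedAddCommGroup F]

/-- The extension by zero of a map on the unit interval to all real times. -/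
def extendTime (k : I → F) : ℝ → F := (Icc 0 1).indicator (IccExtend zero_le_one k)

theorem extendTime_coe (k : I → F) (t : I) : extendTime k t = k t := by
  rw [extendTime, indicator_of_mem t.2, IccExtend_val]

theorem extendTime_of_notMem (k : I → F) {t : ℝ} (ht : t ∉ Icc (0 : ℝ) 1) : extendTime k t = 0 :=
  indicator_of_notMem ht _

theorem eq_extendTime {k : I → F} {g : ℝ → F} (hg : ∀ t : I, g t = k t)
    (h₀ : ∀ t ∉ Icc (0 : ℝ) 1, g t = 0) : g = extendTime k := by
  funext t
  by_cases ht : t ∈ Icc (0 : ℝ) 1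
  · exact (hg ⟨t, ht⟩).trans (extendTime_coe k ⟨t, ht⟩).symm
  · rw [h₀ t ht, extendTime_of_notMem k ht]

theorem integrableOn_extendTime_iff {k : I → F} :
    IntegrableOn (extendTime k) (Icc 0 1) ↔ Integrable k := by
  have hcomp : extendTime k ∘ (↑) = k := funext (extendTime_coe k)
  rw [IntegrableOn, ← unitInterval.measurePreserving_coe.integrable_comp_emb
    unitInterval.measurableEmbedding_coe, hcomp]

theorem locallyIntegrable_extendTime {k : I → F} (hk : Integrable k) :
    LocallyIntegrable (extendTime k) :=
  ((integrableOn_iff_integrable_of_support_subset support_indicator_subset).1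
    (integrableOn_extendTime_iff.2 hk)).locallyIntegrable

theorem locallyIntegrable_velocity {V : Type*} [NormedAddCommGroup V] (v : Velocity V) :
    LocallyIntegrable (extendTime v) :=
  locallyIntegrable_extendTime ((Lp.memLp v).integrable one_le_two)

variable [NormedSpace ℝ F]

theorem setIntegral_Iic_eq (k : I → F) (t : I) :
    ∫ s in Iic t, k s = ∫ s in (0 : ℝ)..t, extendTime k s := by
  have htransfer := unitInterval.measurePreserving_coe.setIntegral_preimage_emb
    unitInterval.measurableEmbedding_coe (extendTime k) (Iic (t : ℝ))
  have hinter : Iic (t : ℝ) ∩ I = Icc 0 (t : ℝ) := by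
    ext s
    exact ⟨fun hs => ⟨hs.2.1, hs.1⟩, fun hs => ⟨hs.2, hs.1, hs.2.trans t.2.2⟩⟩
  rw [Measure.restrict_restrict measurableSet_Iic, hinter,
    integral_Icc_eq_integral_Ioc, ← intervalIntegral.integral_of_le t.2.1] at htransfer
  simpa only [extendTime_coe] using! htransfer

theorem IsPrimitive.eq_projIcc {γ g : ℝ → F} (h : IsPrimitive γ g)
    (h₀ : ∀ t ∉ Icc (0 : ℝ) 1, g t = 0) (t : ℝ) :
    γ t = γ (projIcc 0 1 zero_le_one t) := by
  rw [← sub_eq_zero, h.2]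
  refine intervalIntegral.integral_zero_ae ?_
  filter_upwards [Measure.ae_ne volume 0] with s hs0 hs
  refine h₀ s fun hsI => ?_
  rcases lt_or_ge t 0 with ht | ht
  · rw [projIcc_of_le_left _ ht.le, uIoc_of_ge ht.le] at hs
    exact hs0 (le_antisymm hs.2 hsI.1)
  rcases le_or_gt t 1 with ht' | ht'
  · rw [projIcc_of_mem _ ⟨ht, ht'⟩, uIoc_of_le le_rfl, Ioc_self] at hs
    exact hs
  · rw [projIcc_of_right_le _ ht'.le, uIoc_of_le ht'.le] at hs
    exact hs.1.not_ge hsI.2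

theorem isPrimitive_IccExtend_iff {γ k : I → F} :
    IsPrimitive (IccExtend zero_le_one γ) (extendTime k) ↔
      Integrable k ∧ ∀ t : I, γ t = γ 0 + ∫ s in Iic t, k s := by
  constructor
  · refine fun h => ⟨integrableOn_extendTime_iff.1 (h.1.integrableOn_isCompact isCompact_Icc),
      fun t => ?_⟩
    have hadd := h.eq_add ((0 : I) : ℝ) t
    rwa [IccExtend_val, IccExtend_val, Icc.coe_zero, ← setIntegral_Iic_eq] at hadd
  · rintro ⟨hk, hadd⟩
    have hloc := locallyIntegrable_extendTime hk
    refine isPrimitive_of_eq_add_integral (x := γ 0) (t₀ := 0) hloc fun t => ?_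
    rw [IccExtend, Function.comp_apply, hadd, setIntegral_Iic_eq,
      ← (isPrimitive_integral hloc 0).eq_projIcc fun _ => extendTime_of_notMem k]

end Time

/-! ### The diffeomorphisms generated by a velocity field -/

section Diffeomorphisms

variable {n : ℕ} {Ω : TopologicalSpace.Opens (Euc n)}
  {V : Type*} [NormedAddCommGroup V] [InnerProductSpace ℝ V]
  {ev : V →ₗ[ℝ] (Ω → Euc n)} {v : Velocity V}

theorem Diffeo.ext {φ ψ : Diffeo Ω} (h : ∀ x, φ.toEquiv x = ψ.toEquiv x) : φ = ψ := by
  obtain ⟨e, _, _⟩ := φ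
  obtain ⟨e', _, _⟩ := ψ
  obtain rfl : e = e' := Equiv.ext h
  rfl

theorem extendedField_coe (u : V) (x : Ω) : extendedField ev u x = ev u x :=
  extendZero_coe (ev u) x

theorem extendedField_extendTime_of_notMem (k : I → V) {t : ℝ} (ht : t ∉ Icc (0 : ℝ) 1) :
    extendedField ev (extendTime k t) = 0 := by
  rw [extendTime_of_notMem k ht, map_zero]

theorem isFlow_iff_isPrimitive {φ : I → Diffeo Ω} :
    IsFlow ev v φ ↔ ∀ x : Ω, ((φ 0).toEquiv x : Euc n) = x ∧
      IsPrimitive (IccExtend zero_le_one fun t => ((φ t).toEquiv x : Euc n))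
        fun t => extendedField ev (extendTime v t)
          (IccExtend zero_le_one (fun t => ((φ t).toEquiv x : Euc n)) t) := by
  refine forall_congr' fun x => ?_
  have hrate : (fun t => extendedField ev (extendTime v t)
      (IccExtend zero_le_one (fun t => ((φ t).toEquiv x : Euc n)) t)) =
      extendTime fun s => ev (v s) ((φ s).toEquiv x) :=
    eq_extendTime (fun t => by rw [extendTime_coe, IccExtend_val, extendedField_coe])
      fun t ht => by rw [extendedField_extendTime_of_notMem _ ht, Pi.zero_apply]
  rw [hrate, isPrimitive_IccExtend_iff]
  have hzero : ∫ s in Iic (0 : I), ev (v s) ((φ s).toEquiv x) = 0 := by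
    rw [setIntegral_Iic_eq, Icc.coe_zero, intervalIntegral.integral_same]
  constructor
  · rintro ⟨hint, hadd⟩
    have hstart : ((φ 0).toEquiv x : Euc n) = x := by rw [hadd 0, hzero, add_zero]
    exact ⟨hstart, hint, fun t => by rw [hstart, hadd t]⟩
  · rintro ⟨hstart, hint, hadd⟩
    exact ⟨hint, fun t => by rw [hadd t, hstart]⟩

namespace IsC1Family

variable {C : ℝ} (h : IsC1Family (extendedField ev) C) (v)

theorem flow_of_notMem (s t : ℝ) {x : Euc n} (hx : x ∉ Ω) :
    h.flow (locallyIntegrable_velocity v) s t x = x := by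
  have hrest : ∀ r, extendedField ev (extendTime v r) x = 0 := fun r => extendZero_of_notMem _ hx
  refine ((h.isC1Caratheodory (locallyIntegrable_velocity v)).eq_flow
    (γ := fun _ => x) ?_ s t).symm
  simpa only [hrest] using isPrimitive_const x

theorem flow_mem (s t : ℝ) {x : Euc n} (hx : x ∈ Ω) :
    h.flow (locallyIntegrable_velocity v) s t x ∈ Ω := by
  by_contra hflow
  have hback := h.flow_of_notMem v t s hflow
  rw [flow_flow, flow_self] at hback
  exact hflow (hback ▸ hx)

theorem flow_projIcc (t : ℝ) (x : Euc n) :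
    h.flow (locallyIntegrable_velocity v) 0 t x =
      h.flow (locallyIntegrable_velocity v) 0 (projIcc 0 1 zero_le_one t) x :=
  (h.isPrimitive_flow (locallyIntegrable_velocity v) 0 x).eq_projIcc
    (fun s hs => by rw [extendedField_extendTime_of_notMem _ hs, Pi.zero_apply]) t

/-- The diffeomorphisms of `Ω` obtained by restricting to `Ω` the flow of the extended velocity
field, started at time `0`. -/
def diffeo (t : I) : Diffeo Ω where
  toEquiv :=
    { toFun := fun x => ⟨h.flow (locallyIntegrable_velocity v) 0 t x, h.flow_mem v 0 t x.2⟩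
      invFun := fun x => ⟨h.flow (locallyIntegrable_velocity v) t 0 x, h.flow_mem v t 0 x.2⟩
      left_inv := fun x => Subtype.ext (by simp only [flow_flow, flow_self])
      right_inv := fun x => Subtype.ext (by simp only [flow_flow, flow_self]) }
  isC1 := isC1_of_contDiff
    ((h.isC1Caratheodory (locallyIntegrable_velocity v)).contDiff_flow 0 t) fun _ => rfl
  isC1_symm := isC1_of_contDiff
    ((h.isC1Caratheodory (locallyIntegrable_velocity v)).contDiff_flow t 0) fun _ => rfl

theorem diffeo_zero_apply (x : Ω) : (h.diffeo v 0).toEquiv x = x :=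
  Subtype.ext (h.flow_self (locallyIntegrable_velocity v) 0 x)

theorem isFlow_diffeo : IsFlow ev v (h.diffeo v) := by
  refine isFlow_iff_isPrimitive.2 fun x => ⟨congrArg _ (h.diffeo_zero_apply v x), ?_⟩
  have hflow : (IccExtend zero_le_one fun t => ((h.diffeo v t).toEquiv x : Euc n)) =
      fun t => h.flow (locallyIntegrable_velocity v) 0 t x :=
    funext fun t => (h.flow_projIcc v t x).symm
  rw [hflow]
  exact h.isPrimitive_flow (locallyIntegrable_velocity v) 0 x

theorem isFlow_iff_eq_diffeo {φ : I → Diffeo Ω} : IsFlow ev v φ ↔ φ = h.diffeo v := by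
  refine ⟨fun hφ => funext fun t => Diffeo.ext fun x => Subtype.ext ?_, fun hφ =>
    hφ ▸ h.isFlow_diffeo v⟩
  obtain ⟨hstart, hprim⟩ := isFlow_iff_isPrimitive.1 hφ x
  have huniq := (h.isC1Caratheodory (locallyIntegrable_velocity v)).eq_flow hprim 0 t
  rwa [IccExtend_left, IccExtend_val, show (⟨0, left_mem_Icc.2 zero_le_one⟩ : I) = 0 from rfl,
    hstart] at huniq

end IsC1Family

end Diffeomorphisms

/-! ### First-order equations along the flow -/

section Equations

variable {n : ℕ} {Ω : TopologicalSpace.Opens (Euc n)}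
  {V : Type*} [NormedAddCommGroup V] [InnerProductSpace ℝ V]
  {ev : V →ₗ[ℝ] (Ω → Euc n)} (v : Velocity V) (q : (Euc n →L[ℝ] Euc n) →L[ℝ] ℝ)

/-- The equation `∂ₜ f + Df(v) + q(Dv) f = 0` on `[0,1] × Ω` in the Carathéodory sense. It is the
transport equation for `q = 0` and the continuity equation when `q` is the trace. -/
def FirstOrderEquation (ev : V →ₗ[ℝ] (Ω → Euc n)) (q : (Euc n →L[ℝ] Euc n) →L[ℝ] ℝ)
    (f : I → Ω → ℝ) (v : Velocity V) : Prop :=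
  ∀ x : Ω,
    Integrable (fun s : I => jac (f s) x (ev (v s) x) + q (jac (ev (v s)) x) * f s x) ∧
    ∀ t : I, f t x = f 0 x -
      ∫ s in Iic t, (jac (f s) x (ev (v s) x) + q (jac (ev (v s)) x) * f s x)

theorem inner_grad (f : Ω → ℝ) (x : Ω) (w : Euc n) : inner ℝ (grad f x) w = jac f x w := by
  rw [grad, gradient, InnerProductSpace.toDual_symm_apply, jac]

theorem toDual_grad (f : Ω → ℝ) (x : Ω) :
    InnerProductSpace.toDual ℝ (Euc n) (grad f x) = jac f x :=
  LinearIsometryEquiv.apply_symm_apply _ _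

theorem transportEquation_iff (f : I → Ω → ℝ) :
    TransportEquation ev f v ↔ FirstOrderEquation ev 0 f v := by
  simp only [TransportEquation, FirstOrderEquation, inner_grad, zero_apply, zero_mul, add_zero]

theorem divergence_smul {f : Ω → ℝ} {u : Ω → Euc n} (hf : IsC1 f) (hu : IsC1 u) (x : Ω) :
    divergence (fun y => f y • u y) x = jac f x (u x) + traceCLM (Euc n) (jac u x) * f x := by
  have hprod := jac_eq_of_hasFDerivAt (u := fun y => f y • u y)
    ((hf.hasFDerivAt x).smul (hu.hasFDerivAt x)) fun y => by
      simp only [Pi.smul_apply', extendZero_coe]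
  have htrace : ∀ A : Euc n →L[ℝ] Euc n,
      LinearMap.trace ℝ (Euc n) (A : Euc n →ₗ[ℝ] Euc n) = traceCLM (Euc n) A :=
    fun A => rfl
  rw [divergence, hprod, extendZero_coe, extendZero_coe, htrace, map_add, map_smul, smul_eq_mul,
    add_comm, mul_comm (f x)]
  congr 1
  exact LinearMap.trace_smulRight _ _

theorem continuityEquation_iff (hev : ∀ u, IsC1 (ev u)) {f : I → Ω → ℝ} (hf : ∀ t, IsC1 (f t)) :
    ContinuityEquation ev f v ↔ FirstOrderEquation ev (traceCLM (Euc n)) f v := by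
  have hdiv : ∀ s x, divergence (fun y => f s y • ev (v s) y) x =
      jac (f s) x (ev (v s) x) + traceCLM (Euc n) (jac (ev (v s)) x) * f s x := fun s =>
    divergence_smul (hf s) (hev (v s))
  simp only [ContinuityEquation, FirstOrderEquation, hdiv]

theorem IsC1Trajectory.isC1InSpace {f : I → Ω → ℝ} (hf : IsC1Trajectory f)
    (hC1 : ∀ t, IsC1 (f t)) :
    IsC1InSpace (Ω : Set (Euc n)) (IccExtend zero_le_one fun t => extendZero (f t)) := by
  have hj : IsOpenEmbedding (Prod.map id (↑) : ℝ × Ω → ℝ × Euc n) :=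
    IsOpenEmbedding.id.prodMap Ω.isOpen.isOpenEmbedding_subtypeVal
  have hproj : Continuous fun p : ℝ × Ω => (projIcc (0 : ℝ) 1 zero_le_one p.1, p.2) :=
    (continuous_projIcc.comp continuous_fst).prodMk continuous_snd
  have hcont : ∀ {G : Type} [TopologicalSpace G] {F : ℝ × Euc n → G},
      Continuous (F ∘ Prod.map id ((↑) : Ω → Euc n)) → ContinuousOn F (univ ×ˢ (Ω : Set (Euc n))) :=
    fun hF p hp => ((hj.continuousAt_iff (x := (p.1, ⟨p.2, hp.2⟩))).1
      hF.continuousAt).continuousWithinAt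
  refine ⟨fun t x hx => ((hC1 _).hasFDerivAt ⟨x, hx⟩).differentiableAt, hcont ?_, hcont ?_⟩
  · exact (hf.1.comp hproj).congr fun p => (extendZero_coe _ p.2).symm
  · exact ((InnerProductSpace.toDual ℝ (Euc n)).continuous.comp (hf.2.comp hproj)).congr
      fun p => toDual_grad _ p.2

theorem jac_geometricAction {T : Ω → ℝ} (hT : IsC1 T) (φ : Diffeo Ω) (x : Ω) :
    jac (geometricAction φ T) x =
      jac T (φ.toEquiv.symm x) ∘L jac (fun y => (φ.toEquiv.symm y : Euc n)) x := by
  have hinner := φ.isC1_symm.hasFDerivAt x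
  have houter := hT.hasFDerivAt (φ.toEquiv.symm x)
  rw [← extendZero_coe (fun y => (φ.toEquiv.symm y : Euc n)) x] at houter
  refine jac_eq_of_hasFDerivAt (houter.comp (x : Euc n) hinner) fun y => ?_
  rw [Function.comp_apply, extendZero_coe, extendZero_coe, geometricAction]

namespace IsC1Family

variable {C : ℝ} (h : IsC1Family (extendedField ev) C)

theorem firstOrderEquation_iff_isPrimitive (f : I → Ω → ℝ) :
    FirstOrderEquation ev q f v ↔ ∀ x ∈ (Ω : Set (Euc n)),
      IsPrimitive (fun t => IccExtend zero_le_one (fun s => extendZero (f s)) t x) fun t =>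
        h.eulerianRate q (IccExtend zero_le_one fun s => extendZero (f s)) t x
          (extendTime v t) := by
  have hpoint : ∀ x : Ω,
      IsPrimitive (fun t => IccExtend zero_le_one (fun s => extendZero (f s)) t x) (fun t =>
        h.eulerianRate q (IccExtend zero_le_one fun s => extendZero (f s)) t x
          (extendTime v t)) ↔
      Integrable (fun s : I => jac (f s) x (ev (v s) x) + q (jac (ev (v s)) x) * f s x) ∧
      ∀ t : I, f t x = f 0 x -
        ∫ s in Iic t, (jac (f s) x (ev (v s) x) + q (jac (ev (v s)) x) * f s x) := fun x => by
    have hpath : (fun t => IccExtend zero_le_one (fun s => extendZero (f s)) t x) =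
        IccExtend zero_le_one fun s => f s x := funext fun t => extendZero_coe _ x
    have hrate : (fun t => h.eulerianRate q (IccExtend zero_le_one fun s => extendZero (f s)) t x
        (extendTime v t)) =
        extendTime fun s => -(jac (f s) x (ev (v s) x) + q (jac (ev (v s)) x) * f s x) := by
      refine eq_extendTime (fun s => ?_) fun t ht => by rw [extendTime_of_notMem _ ht, map_zero]
      rw [eulerianRate_apply, lagrangianRate_apply, extendTime_coe, IccExtend_val, extendZero_coe,
        extendedField_coe, smul_eq_mul, neg_add_rev, sub_eq_add_neg]
      rfl
    simp only [hpath, hrate, isPrimitive_IccExtend_iff, integral_neg, sub_eq_add_neg]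
    exact and_congr_left' integrable_neg_iff
  exact ⟨fun H x hx => (hpoint ⟨x, hx⟩).2 (H ⟨x, hx⟩), fun H x => (hpoint x).1 (H x x.2)⟩

/-- The factor by which the solutions of `FirstOrderEquation ev q` are multiplied between the times
`0` and `t` along the trajectory of `y`. -/
def characteristicFactor (t : ℝ) (y : Euc n) : ℝ :=
  Real.exp (-∫ r in 0..t, q (fderiv ℝ (extendedField ev (extendTime v r))
    (h.flow (locallyIntegrable_velocity v) 0 r y)))

theorem characteristicFactor_projIcc (t : ℝ) (y : Euc n) :
    h.characteristicFactor v q t y =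
      h.characteristicFactor v q (projIcc 0 1 zero_le_one t) y := by
  have hint := isPrimitive_integral
    (h.locallyIntegrable_fderiv_flow (locallyIntegrable_velocity v) q 0 y) 0
  have hrest : ∀ r ∉ Icc (0 : ℝ) 1, q (fderiv ℝ (extendedField ev (extendTime v r))
      (h.flow (locallyIntegrable_velocity v) 0 r y)) = 0 := fun r hr => by
    rw [extendedField_extendTime_of_notMem _ hr, fderiv_zero, Pi.zero_apply, map_zero]
  rw [characteristicFactor, characteristicFactor, hint.eq_projIcc hrest]

theorem characteristicFactor_zero (y : Euc n) : h.characteristicFactor v q 0 y = 1 := by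
  rw [characteristicFactor, intervalIntegral.integral_same, neg_zero, Real.exp_zero]

theorem firstOrderEquation_iff_apply_diffeo {f : I → Ω → ℝ} (hf : IsC1Trajectory f)
    (hC1 : ∀ t, IsC1 (f t)) :
    FirstOrderEquation ev q f v ↔ ∀ (t : I) (y : Ω),
      f t ((h.diffeo v t).toEquiv y) = f 0 y * h.characteristicFactor v q t y := by
  rw [h.firstOrderEquation_iff_isPrimitive, h.isPrimitive_eulerianRate_iff
    (locallyIntegrable_velocity v) q Ω.isOpen (hf.isC1InSpace hC1)
    (fun s t x hx => h.flow_mem v s t hx) 0]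
  have hval : ∀ (t : ℝ) (y : Ω), IccExtend zero_le_one (fun s => extendZero (f s)) t
      (h.flow (locallyIntegrable_velocity v) 0 t y) =
      f (projIcc 0 1 zero_le_one t) ((h.diffeo v (projIcc 0 1 zero_le_one t)).toEquiv y) :=
    fun t y => by
      rw [h.flow_projIcc]
      exact extendZero_coe _ ((h.diffeo v _).toEquiv y)
  have hinit : ∀ y : Ω, IccExtend zero_le_one (fun s => extendZero (f s)) 0 y = f 0 y :=
    fun y => by
      rw [IccExtend_left]
      exact extendZero_coe _ y
  constructor
  · intro H t y
    have hy := H y y.2 t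
    rwa [hval, hinit, projIcc_val] at hy
  · intro H y hy t
    rw [hval t ⟨y, hy⟩, hinit ⟨y, hy⟩, H]
    exact congrArg _ (h.characteristicFactor_projIcc v q t y).symm

theorem geometricAction_diffeo (T : Ω → ℝ) (t : I) (y : Ω) :
    geometricAction (h.diffeo v t) T ((h.diffeo v t).toEquiv y) =
      T y * h.characteristicFactor v 0 t y := by
  simp [geometricAction, characteristicFactor]

theorem jac_diffeo_symm (t : I) (x : Ω) :
    jac (fun y => ((h.diffeo v t).toEquiv.symm y : Euc n)) x =
      (h.isC1Caratheodory (locallyIntegrable_velocity v)).flowDeriv t 0 x :=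
  jac_eq_of_hasFDerivAt
    ((h.isC1Caratheodory (locallyIntegrable_velocity v)).hasFDerivAt_flow t 0 x) fun _ => rfl

theorem massAction_diffeo (T : Ω → ℝ) (t : I) (y : Ω) :
    massAction (h.diffeo v t) T ((h.diffeo v t).toEquiv y) =
      T y * h.characteristicFactor v (traceCLM (Euc n)) t y := by
  have hback : ∀ r, (h.isC1Caratheodory (locallyIntegrable_velocity v)).flow t r
      ((h.diffeo v t).toEquiv y) = h.flow (locallyIntegrable_velocity v) 0 r y := fun r =>
    h.flow_flow (locallyIntegrable_velocity v) 0 t r y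
  rw [massAction, h.jac_diffeo_symm, IsC1Caratheodory.det_flowDeriv, Equiv.symm_apply_apply,
    mul_comm, intervalIntegral.integral_symm, characteristicFactor]
  simp only [hback]

theorem continuous_diffeo_symm :
    Continuous fun p : I × Ω => (h.diffeo v p.1).toEquiv.symm p.2 :=
  continuous_induced_rng.2
    (((h.isC1Caratheodory (locallyIntegrable_velocity v)).continuous_flow_symm 0).comp
      (continuous_subtype_val.prodMap continuous_subtype_val))

theorem continuous_jac_diffeo_symm :
    Continuous fun p : I × Ω => jac (fun y => ((h.diffeo v p.1).toEquiv.symm y : Euc n)) p.2 := by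
  simp only [jac_diffeo_symm]
  exact ((h.isC1Caratheodory (locallyIntegrable_velocity v)).continuous_flowDeriv_symm 0).comp
    (continuous_subtype_val.prodMap continuous_subtype_val)

theorem isC1Trajectory_geometricAction {T : Ω → ℝ} (hT : IsC1 T) :
    IsC1Trajectory (orbit geometricAction T (h.diffeo v)) := by
  refine ⟨hT.continuous.comp (h.continuous_diffeo_symm v), ?_⟩
  have hjac : Continuous fun p : I × Ω => (InnerProductSpace.toDual ℝ (Euc n)).symm
      (jac (orbit geometricAction T (h.diffeo v) p.1) p.2) := by
    simp only [orbit, jac_geometricAction hT]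
    exact (InnerProductSpace.toDual ℝ (Euc n)).symm.continuous.comp
      ((hT.continuous_jac.comp (h.continuous_diffeo_symm v)).clm_comp
        (h.continuous_jac_diffeo_symm v))
  exact hjac

end IsC1Family

end Equations

/-! ### Equivalence of minimization problems -/

namespace MinProblem

variable {α β : Type*} {P : MinProblem α} {Q : MinProblem β} {F : α → β}

theorem value_eq_of_image_eq (hF : F '' P.feasible = Q.feasible)
    (hobj : ∀ a ∈ P.feasible, Q.objective (F a) = P.objective a) : P.value = Q.value := by
  rw [value, value, ← hF, iInf_image]
  exact (biInf_congr hobj).symm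

theorem isSolution_apply_iff (hF : F '' P.feasible = Q.feasible)
    (hobj : ∀ a ∈ P.feasible, Q.objective (F a) = P.objective a) {a : α} (ha : a ∈ P.feasible) :
    Q.IsSolution (F a) ↔ P.IsSolution a := by
  rw [IsSolution, IsSolution, ← hF, forall_mem_image, hobj a ha]
  exact and_congr (iff_of_true (mem_image_of_mem F ha) ha)
    (forall₂_congr fun b hb => by rw [hobj b hb])

end MinProblem

section Equivalence

variable {n : ℕ} {Ω : TopologicalSpace.Opens (Euc n)}
  {V : Type*} [NormedAddCommGroup V] {act : Diffeo Ω → (Ω → ℝ) → (Ω → ℝ)}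

theorem areEquivalent_of_bijOn {P : MinProblem ((Ω → ℝ) × Velocity V × (I → Diffeo Ω))}
    {Q : MinProblem ((I → Ω → ℝ) × Velocity V)}
    (hbij : BijOn (fun p => (orbit act p.1 p.2.2, p.2.1)) P.feasible Q.feasible)
    (hobj : ∀ T v φ, (T, v, φ) ∈ P.feasible →
      orbit act T φ 0 = T ∧ Q.objective (orbit act T φ, v) = P.objective (T, v, φ)) :
    AreEquivalent act P Q := by
  have hsol : ∀ T v φ, (T, v, φ) ∈ P.feasible →
      (Q.IsSolution (orbit act T φ, v) ↔ P.IsSolution (T, v, φ)) := fun T v φ =>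
    MinProblem.isSolution_apply_iff hbij.image_eq fun _ hp => (hobj _ _ _ hp).2
  refine ⟨hbij, hobj, MinProblem.value_eq_of_image_eq hbij.image_eq fun _ hp =>
    (hobj _ _ _ hp).2, fun T v φ hp => (hsol T v φ hp.1).2 hp, fun f v hq => ?_⟩
  obtain ⟨⟨T, w, φ⟩, hp, heq⟩ := hbij.surjOn hq.1
  obtain ⟨rfl, rfl⟩ := Prod.mk.inj heq
  rw [(hobj T w φ hp).1]
  exact ⟨φ, (hsol T w φ hp).1 hq, rfl⟩

theorem eq_orbit_iff {f : I → Ω → ℝ} {T : Ω → ℝ} {φ : I → Diffeo Ω} :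
    f = orbit act T φ ↔ ∀ t y, f t ((φ t).toEquiv y) = act (φ t) T ((φ t).toEquiv y) := by
  simp only [funext_iff, orbit]
  exact forall_congr' fun t => (φ t).toEquiv.forall_congr_right.symm

variable [InnerProductSpace ℝ V] {ev : V →ₗ[ℝ] (Ω → Euc n)}
  {Y : Type*} {X : Submodule ℝ (Ω → ℝ)}
  (D : Y → Y → ℝ≥0) (A : I → (Ω → ℝ) → Y) (g : I → Y) (R₁ : (Ω → ℝ) → ℝ≥0) (μ₁ μ₂ : ℝ≥0)
  {pde : (I → Ω → ℝ) → Velocity V → Prop}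

theorem areEquivalent_of_pde_iff_eq_orbit {Φ : Velocity V → I → Diffeo Ω}
    (hΦ : ∀ v φ, IsFlow ev v φ ↔ φ = Φ v) (hzero : ∀ v, ∀ T ∈ X, orbit act T (Φ v) 0 = T)
    (horb : ∀ v, ∀ T ∈ X, (∀ t, orbit act T (Φ v) t ∈ X) ∧ IsC1Trajectory (orbit act T (Φ v)))
    (hpde : ∀ v f, (∀ t, f t ∈ X) → IsC1Trajectory f → (pde f v ↔ f = orbit act (f 0) (Φ v))) :
    AreEquivalent act (jointModel ev X D A g R₁ μ₁ μ₂ act)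
      (pdeProblem X D A g R₁ μ₁ μ₂ pde) := by
  refine areEquivalent_of_bijOn ⟨?_, ?_, ?_⟩ ?_
  · rintro ⟨T, v, φ⟩ ⟨hT : T ∈ X, hφ⟩
    obtain rfl := (hΦ v φ).1 hφ
    obtain ⟨hmem, hC1⟩ := horb v T hT
    exact ⟨hmem, hC1, (hpde v _ hmem hC1).2 (by rw [hzero v T hT])⟩
  · rintro ⟨T, v, φ⟩ ⟨hT, hφ⟩ ⟨T', v', φ'⟩ ⟨hT', hφ'⟩ heq
    obtain ⟨horbit, rfl⟩ := Prod.mk.inj heq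
    obtain rfl := (hΦ v φ).1 hφ
    obtain rfl := (hΦ v φ').1 hφ'
    have hstart := congrFun horbit 0
    rw [hzero v T hT, hzero v T' hT'] at hstart
    rw [hstart]
  · rintro ⟨f, v⟩ ⟨hmem, hC1, heqn⟩
    exact ⟨(f 0, v, Φ v), ⟨hmem 0, (hΦ v _).2 rfl⟩,
      Prod.ext ((hpde v f hmem hC1).1 heqn).symm rfl⟩
  · rintro T v φ ⟨hT, hφ⟩
    obtain rfl := (hΦ v φ).1 hφ
    refine ⟨hzero v T hT, ?_⟩
    simp only [pdeProblem, jointModel, hzero v T hT]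

namespace IsC1Family

variable {C : ℝ} (h : IsC1Family (extendedField ev) C) {q : (Euc n →L[ℝ] Euc n) →L[ℝ] ℝ}

theorem orbit_zero {v : Velocity V} {T : Ω → ℝ}
    (hact : ∀ (t : I) (y : Ω), act (h.diffeo v t) T ((h.diffeo v t).toEquiv y) =
      T y * h.characteristicFactor v q t y) : orbit act T (h.diffeo v) 0 = T := by
  funext y
  simpa only [orbit, diffeo_zero_apply, Icc.coe_zero, characteristicFactor_zero, mul_one]
    using hact 0 y

theorem areEquivalent (hX : ∀ T ∈ X, IsC1 T)
    (hact : ∀ v T (t : I) (y : Ω), act (h.diffeo v t) T ((h.diffeo v t).toEquiv y) =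
      T y * h.characteristicFactor v q t y)
    (hpde : ∀ v f, (∀ t, IsC1 (f t)) → (pde f v ↔ FirstOrderEquation ev q f v))
    (horb : ∀ v, ∀ T ∈ X, (∀ t, orbit act T (h.diffeo v) t ∈ X) ∧
      IsC1Trajectory (orbit act T (h.diffeo v))) :
    AreEquivalent act (jointModel ev X D A g R₁ μ₁ μ₂ act)
      (pdeProblem X D A g R₁ μ₁ μ₂ pde) := by
  refine areEquivalent_of_pde_iff_eq_orbit D A g R₁ μ₁ μ₂ (fun v φ => h.isFlow_iff_eq_diffeo v)
    (fun v T _ => h.orbit_zero (hact v T)) horb fun v f hmem hf => ?_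
  have hC1 : ∀ t, IsC1 (f t) := fun t => hX _ (hmem t)
  rw [hpde v f hC1, h.firstOrderEquation_iff_apply_diffeo v q hf hC1, eq_orbit_iff]
  simp only [hact]

end IsC1Family

end Equivalence

end LDDMM

end

theorem mainTheorem1_general {n : ℕ} (Ω : TopologicalSpace.Opens (Euc n))
    {V : Type*} [NormedAddCommGroup V] [InnerProductSpace ℝ V]
    (ev : V →ₗ[ℝ] (Ω → Euc n)) (hV : IsAdmissible ev)
    (X : Submodule ℝ (Ω → ℝ)) (hX : ∀ T ∈ X, IsC1 T)
    {Y : Type*} (D : Y → Y → ℝ≥0) (A : I → (Ω → ℝ) → Y) (g : I → Y)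
    (R₁ : (Ω → ℝ) → ℝ≥0) (μ₁ μ₂ : ℝ≥0) :
    (∀ v : Velocity V, ∃! φ : I → Diffeo Ω, IsFlow ev v φ) ∧
    ((∀ (v : Velocity V) (φ : I → Diffeo Ω), IsFlow ev v φ → ∀ T ∈ X, ∀ t,
        orbit geometricAction T φ t ∈ X) →
      AreEquivalent geometricAction
        (jointModel ev X D A g R₁ μ₁ μ₂ geometricAction)
        (pdeProblem X D A g R₁ μ₁ μ₂ (TransportEquation ev))) ∧
    ((∀ (v : Velocity V) (φ : I → Diffeo Ω), IsFlow ev v φ → ∀ T ∈ X,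
        (∀ t, orbit massAction T φ t ∈ X) ∧ IsC1Trajectory (orbit massAction T φ)) →
      AreEquivalent massAction
        (jointModel ev X D A g R₁ μ₁ μ₂ massAction)
        (pdeProblem X D A g R₁ μ₁ μ₂ (ContinuityEquation ev))) := by
  obtain ⟨C, h⟩ := hV.exists_isC1Family
  refine ⟨fun v => ?_, fun hgeo => ?_, fun hmass => ?_⟩
  · exact ⟨h.diffeo v, h.isFlow_diffeo v, fun φ hφ => (h.isFlow_iff_eq_diffeo v).1 hφ⟩
  · exact h.areEquivalent D A g R₁ μ₁ μ₂ hX h.geometricAction_diffeo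
      (fun v f _ => transportEquation_iff v f) fun v T hT =>
        ⟨hgeo v _ (h.isFlow_diffeo v) T hT, h.isC1Trajectory_geometricAction v (hX T hT)⟩
  · exact h.areEquivalent D A g R₁ μ₁ μ₂ hX h.massAction_diffeo
      (fun v _ hf => continuityEquation_iff v (fun u => (hV.isC1Zero u).1) hf) fun v T hT =>
        hmass v _ (h.isFlow_diffeo v) T hT

theorem mainTheorem1 {n : ℕ} (Ω : TopologicalSpace.Opens (Euc n))
    {V : Type*} [NormedAddCommGroup V] [InnerProductSpace ℝ V] [CompleteSpace V]
    (ev : V →ₗ[ℝ] (Ω → Euc n)) (hV : IsAdmissible ev)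
    (X : Submodule ℝ (Ω → ℝ)) (hX : ∀ T ∈ X, IsC1 T)
    {Y : Type*} (D : Y → Y → ℝ≥0) (A : I → (Ω → ℝ) → Y) (g : I → Y)
    (R₁ : (Ω → ℝ) → ℝ≥0) (μ₁ μ₂ : ℝ≥0) :
    (∀ v : Velocity V, ∃! φ : I → Diffeo Ω, IsFlow ev v φ) ∧
    ((∀ (v : Velocity V) (φ : I → Diffeo Ω), IsFlow ev v φ → ∀ T ∈ X, ∀ t,
        orbit geometricAction T φ t ∈ X) →
      AreEquivalent geometricAction
        (jointModel ev X D A g R₁ μ₁ μ₂ geometricAction)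
        (pdeProblem X D A g R₁ μ₁ μ₂ (TransportEquation ev))) ∧
    ((∀ (v : Velocity V) (φ : I → Diffeo Ω), IsFlow ev v φ → ∀ T ∈ X,
        (∀ t, orbit massAction T φ t ∈ X) ∧ IsC1Trajectory (orbit massAction T φ)) →
      AreEquivalent massAction
        (jointModel ev X D A g R₁ μ₁ μ₂ massAction)
        (pdeProblem X D A g R₁ μ₁ μ₂ (ContinuityEquation ev))) :=
  mainTheorem1_general Ω ev hV X hX D A g R₁ μ₁ μ₂
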